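/- Let $d,m\ge 1$ be integers with $d=1$ or $m=1$. Let $\Gamma\subset\mathbb{R}^d$ be the lattice generated by a basis $\gamma_1,\dots,\gamma_d$ of $\mathbb{R}^d$, let $\Gamma^*=\{k: k\cdot\gamma\in 2\pi\mathbb{Z}\ \forall\gamma\in\Gamma\}$, let $\mathbb{T}^*_d=\mathbb{R}^d/\Gamma^*$ with Lebesgue measure (integrals over $\mathbb{T}^*_d$ are integrals over the centered fundamental cell $Y^*$ of $\Gamma^*$), let $\mathcal{H}_{\mathrm f}=L^2(\mathbb{R}^d/\Gamma;\mathbb{C})$, and let $(\tau(\lambda)f)(y)=e^{i\lambda\cdot y}f(y)$ for $\lambda\in\Gamma^*$, $f\in\mathcal{H}_{\mathrm f}$. Let $k\mapsto P(k)$ be a smooth map from $\mathbb{R}^d$ to the orthogonal projectors of rank $m$ in $\mathcal{H}_{\mathrm f}$ with $P(k+\lambda)=\tau(\lambda)^{-1}P(k)\tau(\lambda)$ for all $k\in\mathbb{R}^d$, $\lambda\in\Gamma^*$. Let $\chi=(\chi_1,\dots,\chi_m)$ be a real-analytic Bloch frame for $P$: the functions $\chi_a:\mathbb{R}^d\to\mathcal{H}_{\mathrm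 f}$ are real-analytic, satisfy, for every $\lambda\in\Gamma^*$, $\chi_a(k-\lambda)=\tau(\lambda)\chi_a(k)$ for a.e. $k$, satisfy $P(k)\chi_a(k)=\chi_a(k)\neq 0$ for all $k\in Y^*$, and $(\chi_1(k),\dots,\chi_m(k))$ is an orthonormal basis of $\operatorname{Ran}P(k)$ for a.e. $k\in Y^*$. Let $A_j$, $1\le j\le d$, be the matrices of the Berry connection, $[A_j(k)]_{cb}=\langle\chi_c(k),\partial_{k_j}\chi_b(k)\rangle_{\mathcal{H}_{\mathrm f}}$. Let $U\in W^{1,2}(\mathbb{T}^*_d;\mathcal{U}(m))$, that is, $U$ is a $\Gamma^*$-periodic function with values in $M_m(\mathbb{C})$, unitary almost everywhere, that has weak partial derivatives $\partial_jU=\partial U/\partial k_j$ in $L^2(\mathbb{T}^*_d;M_m(\mathbb{C}))$. Put $G^j=\operatorname{diag}\Big(\int_{\mathbb{T}^*_d}U^*\,(\partial_jU+A_jU)\,dk\Big)$, where $[\operatorname{diag}M]_{ab}=M_{aa}\delta_{ab}$, and let $s\in\{1,-1\}$. Suppose that $U$ is a weak solution of $$-\Delta U+\sum_{j=1}^d \partial_jU\,U^{-1}\partial_jU+\sum_{j=1}^d\Big[\partial_jU\,U^{-1}A_jU-(\partial_jA_j)U-A_j\,\partial_jU\Big]+s\sum_{j=1}^d\Big[-(\partial_jU+A_jU)G^j+U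 G^jU^{-1}(\partial_jU+A_jU)\Big]=0,$$ that is, for every $\varphi\in C^\infty(\mathbb{T}^*_d;M_m(\mathbb{C}))$, $$\sum_{j=1}^d\int_{\mathbb{T}^*_d}\operatorname{tr}\Big[(\partial_j\varphi)^*\partial_jU+\varphi^*\Big(\partial_jU\,U^{-1}\partial_jU+\partial_jU\,U^{-1}A_jU-(\partial_jA_j)U-A_j\,\partial_jU+s\big(-(\partial_jU+A_jU)G^j+UG^jU^{-1}(\partial_jU+A_jU)\big)\Big)\Big]dk=0 .$$ Then $U$ is real-analytic: it coincides almost everywhere with a $\Gamma^*$-periodic real-analytic map $V:\mathbb{R}^d\to M_m(\mathbb{C})$ with $V(k)\in\mathcal{U}(m)$ for every $k$. -/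

import Mathlib

open MeasureTheory Set
open scoped Matrix ContDiff InnerProductSpace

namespace BlochGauge

noncomputable section

/-- Euclidean space `ℝ^d`, used both for positions and for (quasi-)momenta. -/
abbrev Space (d : ℕ) := EuclideanSpace ℝ (Fin d)

/-- The lattice `Γ` generated over `ℤ` by the basis `γ`. -/
def lattice {d : ℕ} (γ : Module.Basis (Fin d) ℝ (Space d)) : AddSubgroup (Space d) :=
  AddSubgroup.closure (Set.range γ)

/-- The dual lattice `Γ* = {k : k · g ∈ 2πℤ for all g ∈ Γ}`. -/
def dualLattice {d : ℕ} (γ : Module.Basis (Fin d) ℝ (Space d)) : AddSubgroup (Space d) where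
  carrier := {k | ∀ g ∈ lattice γ, ∃ n : ℤ, ⟪k, g⟫_ℝ = 2 * Real.pi * n}
  zero_mem' := fun _ _ => ⟨0, by simp⟩
  add_mem' := by
    intro x y hx hy g hg
    obtain ⟨n, hn⟩ := hx g hg
    obtain ⟨p, hp⟩ := hy g hg
    exact ⟨n + p, by rw [inner_add_left, hn, hp]; push_cast; ring⟩
  neg_mem' := by
    intro x hx g hg
    obtain ⟨n, hn⟩ := hx g hg
    exact ⟨-n, by rw [inner_neg_left, hn]; push_cast; ring⟩

/-- The centered fundamental domain `Y` of `Γ`. -/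
def cell {d : ℕ} (γ : Module.Basis (Fin d) ℝ (Space d)) : Set (Space d) :=
  {x | ∀ j, γ.repr x j ∈ Set.Icc (-(1 / 2) : ℝ) (1 / 2)}

/-- The centered fundamental domain `Y*` of `Γ*`. The coordinate of `k` along the dual basis
vector `γ*_j` (where `γ*_j · γ_i = 2π δ_{ij}`) is `k · γ_j / 2π`. -/
def dualCell {d : ℕ} (γ : Module.Basis (Fin d) ℝ (Space d)) : Set (Space d) :=
  {k | ∀ j, ⟪k, γ j⟫_ℝ / (2 * Real.pi) ∈ Set.Icc (-(1 / 2) : ℝ) (1 / 2)}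

/-- The torus `ℝ^d / Γ`. -/
abbrev Torus {d : ℕ} (γ : Module.Basis (Fin d) ℝ (Space d)) := Space d ⧸ lattice γ

/-- The flat (Lebesgue) measure of `ℝ^d / Γ`. -/
def torusMeasure {d : ℕ} (γ : Module.Basis (Fin d) ℝ (Space d)) : Measure (Torus γ) :=
  (volume.restrict (cell γ)).map (QuotientAddGroup.mk : Space d → Torus γ)

/-- The fibre Hilbert space `L²(ℝ^d / Γ; ℂ)`. -/
abbrev Fiber {d : ℕ} (γ : Module.Basis (Fin d) ℝ (Space d)) := Lp ℂ 2 (torusMeasure γ)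

/-- The function `y ↦ e^{i l·y}` on `ℝ^d / Γ`, for `l ∈ Γ*`. -/
def phase {d : ℕ} (γ : Module.Basis (Fin d) ℝ (Space d)) (l : dualLattice γ) : Torus γ → ℂ :=
  Quotient.lift (fun y : Space d => Complex.exp (Complex.I * (⟪(l : Space d), y⟫_ℝ : ℂ))) (by
    intro x y hxy
    have h : -x + y ∈ lattice γ := QuotientAddGroup.leftRel_apply.mp hxy
    obtain ⟨n, hn⟩ := l.2 _ h
    have hy : ⟪(l : Space d), y⟫_ℝ = ⟪(l : Space d), x⟫_ℝ + 2 * Real.pi * n := by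
      rw [← hn, ← inner_add_right]; simp
    simp only [hy]
    rw [Complex.exp_eq_exp_iff_exists_int]
    exact ⟨-n, by push_cast; ring⟩)

theorem phase_mk {d : ℕ} (γ : Module.Basis (Fin d) ℝ (Space d)) (l : dualLattice γ)
    (y : Space d) :
    phase γ l (QuotientAddGroup.mk y) = Complex.exp (Complex.I * (⟪(l : Space d), y⟫_ℝ : ℂ)) :=
  rfl

theorem norm_phase {d : ℕ} (γ : Module.Basis (Fin d) ℝ (Space d)) (l : dualLattice γ)
    (y : Torus γ) : ‖phase γ l y‖ = 1 := by
  induction y using QuotientAddGroup.induction_on with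
  | H y => rw [phase_mk, mul_comm]; exact Complex.norm_exp_ofReal_mul_I _

theorem phase_neg_mul {d : ℕ} (γ : Module.Basis (Fin d) ℝ (Space d)) (l : dualLattice γ)
    (y : Torus γ) : phase γ (-l) y * phase γ l y = 1 := by
  induction y using QuotientAddGroup.induction_on with
  | H y =>
    rw [phase_mk, phase_mk, ← Complex.exp_add]
    simp

theorem measurable_phase {d : ℕ} (γ : Module.Basis (Fin d) ℝ (Space d)) (l : dualLattice γ) :
    Measurable (phase γ l) := by
  refine measurable_from_quotient.mpr ?_
  change Measurable fun y : Space d => Complex.exp (Complex.I * (⟪(l : Space d), y⟫_ℝ : ℂ))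
  fun_prop

theorem memLp_phase_mul {d : ℕ} (γ : Module.Basis (Fin d) ℝ (Space d)) (l : dualLattice γ)
    (f : Fiber γ) : MemLp (fun y => phase γ l y * f y) 2 (torusMeasure γ) := by
  refine (Lp.memLp f).of_le
    ((measurable_phase γ l).aestronglyMeasurable.mul (Lp.aestronglyMeasurable f)) ?_
  exact Filter.Eventually.of_forall fun y => by rw [norm_mul, norm_phase, one_mul]

/-- Multiplication by `e^{i l·y}` as a linear map of the fibre space. -/
def tauLin {d : ℕ} (γ : Module.Basis (Fin d) ℝ (Space d)) (l : dualLattice γ) :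
    Fiber γ →ₗ[ℂ] Fiber γ where
  toFun f := (memLp_phase_mul γ l f).toLp _
  map_add' f g := by
    apply Lp.ext
    filter_upwards [(memLp_phase_mul γ l (f + g)).coeFn_toLp, (memLp_phase_mul γ l f).coeFn_toLp,
      (memLp_phase_mul γ l g).coeFn_toLp, Lp.coeFn_add f g,
      Lp.coeFn_add ((memLp_phase_mul γ l f).toLp _) ((memLp_phase_mul γ l g).toLp _)]
      with y h1 h2 h3 h4 h5
    rw [h1, h5, Pi.add_apply, h2, h3, h4, Pi.add_apply, mul_add]
  map_smul' c f := by
    apply Lp.ext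
    filter_upwards [(memLp_phase_mul γ l (c • f)).coeFn_toLp, (memLp_phase_mul γ l f).coeFn_toLp,
      Lp.coeFn_smul c f, Lp.coeFn_smul c ((memLp_phase_mul γ l f).toLp _)] with y h1 h2 h3 h4
    simp only [RingHom.id_apply]
    rw [h1, h4, Pi.smul_apply, h2, h3, Pi.smul_apply, smul_eq_mul, smul_eq_mul]
    ring

theorem tauLin_neg_tauLin {d : ℕ} (γ : Module.Basis (Fin d) ℝ (Space d)) (l : dualLattice γ)
    (f : Fiber γ) : tauLin γ (-l) (tauLin γ l f) = f := by
  apply Lp.ext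
  filter_upwards [(memLp_phase_mul γ (-l) (tauLin γ l f)).coeFn_toLp,
    (memLp_phase_mul γ l f).coeFn_toLp] with y h1 h2
  refine h1.trans ?_
  have h2' : (tauLin γ l f : Torus γ → ℂ) y = phase γ l y * f y := h2
  rw [h2', ← mul_assoc, phase_neg_mul, one_mul]

/-- The unitary representation `τ` of `Γ*` on the fibre space,
`(τ(l) f)(y) = e^{i l·y} f(y)`. -/
def tau {d : ℕ} (γ : Module.Basis (Fin d) ℝ (Space d)) (l : dualLattice γ) :
    Fiber γ ≃ₗᵢ[ℂ] Fiber γ where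
  toLinearEquiv := LinearEquiv.ofLinearMap (tauLin γ l) (tauLin γ (-l))
    (by ext1 f; simpa using tauLin_neg_tauLin γ (-l) f)
    (by ext1 f; exact tauLin_neg_tauLin γ l f)
  norm_map' f := by
    change ‖(memLp_phase_mul γ l f).toLp _‖ = ‖f‖
    rw [Lp.norm_toLp, Lp.norm_def]
    congr 1
    exact eLpNorm_congr_norm_ae (Filter.Eventually.of_forall fun y => by
      rw [norm_mul, norm_phase, one_mul])

/-- A smooth, `τ`-covariant family of rank-`m` orthogonal projectors on the fibre space. -/
structure IsProjectorFamily {d : ℕ} (γ : Module.Basis (Fin d) ℝ (Space d)) (m : ℕ)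
    (P : Space d → Fiber γ →L[ℂ] Fiber γ) : Prop where
  isStarProjection : ∀ k, IsStarProjection (P k)
  rank_range : ∀ k, Module.rank ℂ (P k).range = m
  smooth : ContDiff ℝ ∞ P
  covariant : ∀ (k : Space d) (l : dualLattice γ) (f : Fiber γ),
    P (k + l) f = (tau γ l).symm (P k (tau γ l f))

/-- The space `H_τ` of locally square-integrable `τ`-equivariant functions. -/
structure MemHTau {d : ℕ} (γ : Module.Basis (Fin d) ℝ (Space d))
    (f : Space d → Fiber γ) : Prop where
  locallyL2 : ∀ K : Set (Space d), IsCompact K → MemLp f 2 (volume.restrict K)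
  equivariant : ∀ l : dualLattice γ, ∀ᵐ k : Space d, f (k - l) = tau γ l (f k)

/-- A quasi-Bloch function for the family `P`. -/
structure IsQuasiBloch {d : ℕ} (γ : Module.Basis (Fin d) ℝ (Space d))
    (P : Space d → Fiber γ →L[ℂ] Fiber γ) (f : Space d → Fiber γ) : Prop where
  memHTau : MemHTau γ f
  proj_eq : ∀ k ∈ dualCell γ, P k (f k) = f k
  ne_zero : ∀ k ∈ dualCell γ, f k ≠ 0

/-- A Bloch frame for the family `P`. -/
structure IsBlochFrame {d m : ℕ} (γ : Module.Basis (Fin d) ℝ (Space d))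
    (P : Space d → Fiber γ →L[ℂ] Fiber γ) (χ : Fin m → Space d → Fiber γ) : Prop where
  quasiBloch : ∀ a, IsQuasiBloch γ P (χ a)
  orthonormal : ∀ᵐ k ∂(volume.restrict (dualCell γ)), Orthonormal ℂ fun a => χ a k
  span_eq : ∀ᵐ k ∂(volume.restrict (dualCell γ)),
    Submodule.span ℂ (Set.range fun a => χ a k) = (P k).range

/-- The classical partial derivative `∂F/∂k_j` of a vector-valued function. -/
def partialDeriv {d : ℕ} {F : Type*} [NormedAddCommGroup F] [NormedSpace ℝ F] (j : Fin d)
    (f : Space d → F) (k : Space d) : F :=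
  fderiv ℝ f k (EuclideanSpace.single j 1)

/-- The entrywise classical partial derivative of a matrix-valued function. -/
def matPartialDeriv {d m : ℕ} (j : Fin d) (f : Space d → Matrix (Fin m) (Fin m) ℂ)
    (k : Space d) : Matrix (Fin m) (Fin m) ℂ :=
  Matrix.of fun a b => partialDeriv j (fun q => f q a b) k

/-- The Berry connection, `[A_j(k)]_{cb} = ⟨χ_c(k), ∂χ_b/∂k_j (k)⟩`. -/
def berry {d m : ℕ} {γ : Module.Basis (Fin d) ℝ (Space d)} (χ : Fin m → Space d → Fiber γ)
    (j : Fin d) (k : Space d) : Matrix (Fin m) (Fin m) ℂ :=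
  Matrix.of fun c b => ⟪χ c k, partialDeriv j (χ b) k⟫_ℂ

/-- `Γ*`-periodicity: such functions are the functions on the torus `ℝ^d / Γ*`. -/
def IsPeriodic {d : ℕ} {F : Type*} (γ : Module.Basis (Fin d) ℝ (Space d))
    (f : Space d → F) : Prop :=
  ∀ k, ∀ l ∈ dualLattice γ, f (k + l) = f k

/-- Matrix-valued smooth functions on the torus `ℝ^d / Γ*`. -/
structure IsTestFunction {d m : ℕ} (γ : Module.Basis (Fin d) ℝ (Space d))
    (φ : Space d → Matrix (Fin m) (Fin m) ℂ) : Prop where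
  periodic : IsPeriodic γ φ
  smooth : ∀ a b, ContDiff ℝ ∞ fun k => φ k a b

/-- Matrix-valued square-integrable functions on the torus `ℝ^d / Γ*`. -/
structure MemL2 {d m : ℕ} (γ : Module.Basis (Fin d) ℝ (Space d))
    (f : Space d → Matrix (Fin m) (Fin m) ℂ) : Prop where
  periodic : IsPeriodic γ f
  memLp : ∀ a b, MemLp (fun k => f k a b) 2 (volume.restrict (dualCell γ))

/-- `DU j`, for `j = 1, …, d`, are square-integrable functions on the torus which are the weak
partial derivatives of `U`: `∫ tr((∂_j φ)* U) = - ∫ tr(φ* DU_j)` for all smooth `φ`. -/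
structure IsWeakGradient {d m : ℕ} (γ : Module.Basis (Fin d) ℝ (Space d))
    (U : Space d → Matrix (Fin m) (Fin m) ℂ)
    (DU : Fin d → Space d → Matrix (Fin m) (Fin m) ℂ) : Prop where
  memL2 : ∀ j, MemL2 γ (DU j)
  integral_eq : ∀ j, ∀ φ : Space d → Matrix (Fin m) (Fin m) ℂ, IsTestFunction γ φ →
    ∫ k in dualCell γ, ((matPartialDeriv j φ k)ᴴ * U k).trace
      = -∫ k in dualCell γ, ((φ k)ᴴ * DU j k).trace

/-- The Sobolev space `W^{1,2}(ℝ^d / Γ*; U(m))`. -/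
structure MemW12Unitary {d m : ℕ} (γ : Module.Basis (Fin d) ℝ (Space d))
    (U : Space d → Matrix (Fin m) (Fin m) ℂ) : Prop where
  memL2 : MemL2 γ U
  unitary : ∀ᵐ k : Space d, U k ∈ Matrix.unitaryGroup (Fin m) ℂ
  weakGradient : ∃ DU, IsWeakGradient γ U DU

/-- The constant diagonal matrices `G^j = diag (∫ U* (∂_j U + A_j U) dk)`. -/
def diagMean {d m : ℕ} (γ : Module.Basis (Fin d) ℝ (Space d))
    (A : Fin d → Space d → Matrix (Fin m) (Fin m) ℂ) (U : Space d → Matrix (Fin m) (Fin m) ℂ)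
    (DU : Fin d → Space d → Matrix (Fin m) (Fin m) ℂ) (j : Fin d) : Matrix (Fin m) (Fin m) ℂ :=
  Matrix.diagonal fun a => ∫ k in dualCell γ, ((U k)ᴴ * (DU j k + A j k * U k)) a a

/-- The `j`-th summand of the lower order part of the Euler-Lagrange equation. The factor `s`
in front of the terms with `G^j` is a sign. -/
def lowerOrder {d m : ℕ} (γ : Module.Basis (Fin d) ℝ (Space d)) (s : ℝ)
    (A : Fin d → Space d → Matrix (Fin m) (Fin m) ℂ) (U : Space d → Matrix (Fin m) (Fin m) ℂ)
    (DU : Fin d → Space d → Matrix (Fin m) (Fin m) ℂ) (j : Fin d) (k : Space d) :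
    Matrix (Fin m) (Fin m) ℂ :=
  DU j k * (U k)⁻¹ * DU j k
    + (DU j k * (U k)⁻¹ * A j k * U k - matPartialDeriv j (A j) k * U k - A j k * DU j k)
    + s • (-((DU j k + A j k * U k) * diagMean γ A U DU j)
      + U k * diagMean γ A U DU j * (U k)⁻¹ * (DU j k + A j k * U k))

/-- `U` is a weak solution on the torus `ℝ^d / Γ*` of
`-ΔU + ∑_j ∂_jU U⁻¹ ∂_jU + ∑_j [∂_jU U⁻¹ A_j U - (∂_jA_j) U - A_j ∂_jU]
  + s ∑_j [-(∂_jU + A_j U) G^j + U G^j U⁻¹ (∂_jU + A_j U)] = 0`. -/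
def IsWeakSolution {d m : ℕ} (γ : Module.Basis (Fin d) ℝ (Space d)) (s : ℝ)
    (A : Fin d → Space d → Matrix (Fin m) (Fin m) ℂ)
    (U : Space d → Matrix (Fin m) (Fin m) ℂ) : Prop :=
  ∃ DU, IsWeakGradient γ U DU ∧
    ∀ φ : Space d → Matrix (Fin m) (Fin m) ℂ, IsTestFunction γ φ →
      ∑ j, ∫ k in dualCell γ,
        ((matPartialDeriv j φ k)ᴴ * DU j k + (φ k)ᴴ * lowerOrder γ s A U DU j k).trace = 0

/-- `U`, as a class of functions modulo null sets, is a real-analytic map from the torus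
`ℝ^d / Γ*` to `U(m)`. -/
def IsRealAnalytic {d m : ℕ} (γ : Module.Basis (Fin d) ℝ (Space d))
    (U : Space d → Matrix (Fin m) (Fin m) ℂ) : Prop :=
  ∃ V : Space d → Matrix (Fin m) (Fin m) ℂ,
    IsPeriodic γ V ∧ (∀ k, V k ∈ Matrix.unitaryGroup (Fin m) ℂ) ∧
    (∀ a b, AnalyticOnNhd ℝ (fun k => V k a b) Set.univ) ∧ U =ᵐ[volume] V

end

end BlochGauge

namespace BlochGauge

noncomputable section

open Filter Topology UnitAddTorus
open scoped ComplexConjugate Kronecker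

/-!
In terms of the transformed connection `B_j = U* (∂_jU + A_j U)` the Euler-Lagrange equation
becomes `∑_j ∂_j B_j = s ∑_j [G^j, B_j]`, an equation with constant coefficients. If `d = 1`, the
entry `B_ab` satisfies the scalar equation `∂B_ab = s (G_aa - G_bb) B_ab`, so it is a trigonometric
polynomial. If `m = 1`, the commutators vanish and `B_j = U* ∂_jU + A_j` is divergence free, while
`U* ∂_jU` is curl free because `|U| = 1`; hence `U* ∂_jU` is minus the gradient part of the Hodge
decomposition of the real-analytic field `A`. In both cases the Fourier coefficients of `B` decay
exponentially, and `U` solves the linear system `∂_jU = U B_j - A_j U`, from which the exponential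
decay passes to the Fourier coefficients of `U`.

Functions on `ℝ^d / Γ*` are read as functions on `UnitAddTorus (Fin d)`, and weak derivatives as
relations between Fourier coefficients. As `U` need not be continuous, the product rule for a
bounded function of class `W^{1,2}` and an `L²` field with integrable divergence is obtained by
Fejér summation.
-/

local instance : MeasureSpace UnitAddCircle := ⟨AddCircle.haarAddCircle⟩

local instance : Measure.IsAddHaarMeasure (volume : Measure UnitAddCircle) :=
  inferInstanceAs (Measure.IsAddHaarMeasure AddCircle.haarAddCircle)

local instance : IsProbabilityMeasure (volume : Measure UnitAddCircle) :=
  inferInstanceAs (IsProbabilityMeasure AddCircle.haarAddCircle)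

/-! ### Fourier coefficients on the torus -/

section FourierCoefficients

variable {ι : Type*} [Fintype ι] {f g : UnitAddTorus ι → ℂ}

theorem mFourierCoeff_eq_integral_mul (f : UnitAddTorus ι → ℂ) (n : ι → ℤ) :
    mFourierCoeff f n = ∫ t, mFourier (-n) t * f t := by
  simp only [mFourierCoeff, smul_eq_mul]

theorem norm_mFourier_apply (n : ι → ℤ) (t : UnitAddTorus ι) : ‖mFourier n t‖ = 1 := by
  simp only [mFourier, fourier_apply, ContinuousMap.coe_mk, norm_prod, Circle.norm_coe,
    Finset.prod_const_one]

theorem aestronglyMeasurable_mFourier (n : ι → ℤ) :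
    AEStronglyMeasurable (fun t : UnitAddTorus ι => mFourier n t) volume :=
  (mFourier n).continuous.aestronglyMeasurable

theorem integrable_mFourier_mul (n : ι → ℤ) (hf : Integrable f) :
    Integrable fun t => mFourier n t * f t :=
  hf.bdd_mul (aestronglyMeasurable_mFourier n)
    (Eventually.of_forall fun t => (norm_mFourier_apply n t).le)

theorem memLp_mFourier_mul (n : ι → ℤ) {p : ENNReal} (hf : MemLp f p volume) :
    MemLp (fun t => mFourier n t * f t) p volume :=
  hf.of_le ((aestronglyMeasurable_mFourier n).mul hf.1)
    (Eventually.of_forall fun t => by simp [norm_mFourier_apply])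

theorem mFourierCoeff_congr_ae (h : f =ᵐ[volume] g) (n : ι → ℤ) :
    mFourierCoeff f n = mFourierCoeff g n := by
  simp only [mFourierCoeff_eq_integral_mul]
  refine integral_congr_ae ?_
  filter_upwards [h] with t ht
  rw [ht]

theorem mFourierCoeff_add (hf : Integrable f) (hg : Integrable g) (n : ι → ℤ) :
    mFourierCoeff (fun t => f t + g t) n = mFourierCoeff f n + mFourierCoeff g n := by
  simp only [mFourierCoeff_eq_integral_mul, mul_add]
  exact integral_add (integrable_mFourier_mul _ hf) (integrable_mFourier_mul _ hg)

theorem mFourierCoeff_sub (hf : Integrable f) (hg : Integrable g) (n : ι → ℤ) :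
    mFourierCoeff (fun t => f t - g t) n = mFourierCoeff f n - mFourierCoeff g n := by
  simp only [mFourierCoeff_eq_integral_mul, mul_sub]
  exact integral_sub (integrable_mFourier_mul _ hf) (integrable_mFourier_mul _ hg)

theorem mFourierCoeff_const_mul (c : ℂ) (f : UnitAddTorus ι → ℂ) (n : ι → ℤ) :
    mFourierCoeff (fun t => c * f t) n = c * mFourierCoeff f n := by
  simp only [mFourierCoeff_eq_integral_mul, mul_left_comm _ c]
  exact integral_const_mul _ _

theorem mFourierCoeff_sum {κ : Type*} (s : Finset κ) {F : κ → UnitAddTorus ι → ℂ}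
    (hF : ∀ i ∈ s, Integrable (F i)) (n : ι → ℤ) :
    mFourierCoeff (fun t => ∑ i ∈ s, F i t) n = ∑ i ∈ s, mFourierCoeff (F i) n := by
  simp only [mFourierCoeff_eq_integral_mul, Finset.mul_sum]
  exact integral_finsetSum _ fun i hi => integrable_mFourier_mul _ (hF i hi)

theorem mFourierCoeff_mFourier_mul (f : UnitAddTorus ι → ℂ) (m n : ι → ℤ) :
    mFourierCoeff (fun t => mFourier m t * f t) n = mFourierCoeff f (n - m) := by
  simp only [mFourierCoeff_eq_integral_mul, ← mul_assoc, ← mFourier_add]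
  rw [show -n + m = -(n - m) by abel]

theorem mFourierCoeff_conj (f : UnitAddTorus ι → ℂ) (n : ι → ℤ) :
    mFourierCoeff (fun t => conj (f t)) n = conj (mFourierCoeff f (-n)) := by
  simp only [mFourierCoeff_eq_integral_mul, ← integral_conj, map_mul, ← mFourier_neg, neg_neg]

theorem mFourierCoeff_coeFn_toLp (hf : MemLp f 2 volume) (n : ι → ℤ) :
    mFourierCoeff (hf.toLp f) n = mFourierCoeff f n :=
  mFourierCoeff_congr_ae hf.coeFn_toLp n

theorem ae_eq_of_mFourierCoeff_eq (hf : MemLp f 2 volume) (hg : MemLp g 2 volume)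
    (h : ∀ n, mFourierCoeff f n = mFourierCoeff g n) : f =ᵐ[volume] g := by
  have : hf.toLp f = hg.toLp g := by
    apply mFourierBasis.repr.injective
    ext n
    rw [mFourierBasis_repr, mFourierBasis_repr, mFourierCoeff_coeFn_toLp,
      mFourierCoeff_coeFn_toLp, h]
  exact (MemLp.toLp_eq_toLp_iff hf hg).mp this

theorem mFourierCoeff_mFourier (m n : ι → ℤ) :
    mFourierCoeff (fun t => mFourier m t) n = if n = m then 1 else 0 := by
  have h := orthonormal_iff_ite.mp (orthonormal_mFourier (d := ι)) n m
  rw [← h, ContinuousMap.inner_toLp, mFourierCoeff_eq_integral_mul]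
  simp only [mFourier_neg, mul_comm]

theorem mFourierCoeff_one (n : ι → ℤ) :
    mFourierCoeff (fun _ : UnitAddTorus ι => (1 : ℂ)) n = if n = 0 then 1 else 0 := by
  rw [← mFourierCoeff_mFourier, mFourier_zero]
  rfl

theorem norm_mFourierCoeff_le_integral (f : UnitAddTorus ι → ℂ) (n : ι → ℤ) :
    ‖mFourierCoeff f n‖ ≤ ∫ t, ‖f t‖ := by
  rw [mFourierCoeff_eq_integral_mul]
  exact (norm_integral_le_integral_norm _).trans_eq (by simp only [norm_mul, norm_mFourier_apply,
    one_mul])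

theorem norm_mFourierCoeff_le {C : ℝ} (h : ∀ᵐ t, ‖f t‖ ≤ C) (n : ι → ℤ) :
    ‖mFourierCoeff f n‖ ≤ C := by
  rw [mFourierCoeff_eq_integral_mul]
  have := norm_integral_le_of_norm_le_const (μ := (volume : Measure (UnitAddTorus ι)))
    (f := fun t => mFourier (-n) t * f t) (C := C) (by
      filter_upwards [h] with t ht
      simpa [norm_mFourier_apply] using ht)
  simpa using this

theorem memLp_mFourier_mul_conj (hg : MemLp g 2 volume) (n : ι → ℤ) :
    MemLp (fun t => mFourier n t * conj (g t)) 2 volume :=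
  memLp_mFourier_mul n hg.star

theorem mFourierCoeff_mul_eq_inner (hf : MemLp f 2 volume) (hg : MemLp g 2 volume) (n : ι → ℤ) :
    mFourierCoeff (fun t => f t * g t) n =
      ⟪(memLp_mFourier_mul_conj hg n).toLp _, hf.toLp f⟫_ℂ := by
  rw [mFourierCoeff_eq_integral_mul, L2.inner_def]
  refine integral_congr_ae ?_
  filter_upwards [(memLp_mFourier_mul_conj hg n).coeFn_toLp, hf.coeFn_toLp] with t h₁ h₂
  rw [h₁, h₂, RCLike.inner_apply, map_mul, ← mFourier_neg, Complex.conj_conj]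
  ring

theorem hasSum_mFourierCoeff_mul (hf : MemLp f 2 volume) (hg : MemLp g 2 volume) (n : ι → ℤ) :
    HasSum (fun m => mFourierCoeff f m * mFourierCoeff g (n - m))
      (mFourierCoeff (fun t => f t * g t) n) := by
  rw [mFourierCoeff_mul_eq_inner hf hg n, L2.inner_def]
  have h := hasSum_prod_mFourierCoeff ((memLp_mFourier_mul_conj hg n).toLp _) (hf.toLp _)
  simp only [mFourierCoeff_coeFn_toLp, mFourierCoeff_mFourier_mul, mFourierCoeff_conj,
    Complex.conj_conj, neg_sub] at h
  simpa only [RCLike.inner_apply, mul_comm] using h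

theorem hasSum_norm_sq_mFourierCoeff (f : Lp ℂ 2 (volume : Measure (UnitAddTorus ι))) :
    HasSum (fun n => ‖mFourierCoeff f n‖ ^ 2) (‖f‖ ^ 2) := by
  have h := lp.hasSum_norm (by norm_num) (mFourierBasis.repr f)
  simpa only [LinearIsometryEquiv.norm_map, mFourierBasis_repr, ENNReal.toReal_ofNat,
    Real.rpow_ofNat] using h

end FourierCoefficients

/-! ### Derivatives and divergences in terms of Fourier coefficients -/

section FourierDerivatives

variable {ι κ : Type*} [Fintype ι] {f g f' g' : UnitAddTorus ι → ℂ} {θ : (ι → ℤ) →+ ℂ}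

/-- `g` is the weak derivative of `f` along the direction with Fourier symbol `θ`: for instance
`θ n = 2πi nⱼ` for the partial derivative in the `j`-th coordinate of the unit torus. Additivity of
`θ` is what makes the Leibniz rule hold. -/
def HasFourierDeriv (θ : (ι → ℤ) →+ ℂ) (f g : UnitAddTorus ι → ℂ) : Prop :=
  ∀ n, mFourierCoeff g n = θ n * mFourierCoeff f n

theorem integrable_mul_of_memLp_two (hf : MemLp f 2 volume) (hg : MemLp g 2 volume) :
    Integrable fun t => f t * g t :=
  hf.integrable_mul hg

theorem HasFourierDeriv.mul (h : HasFourierDeriv θ f f')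
    (k : HasFourierDeriv θ g g') (hf : MemLp f 2 volume) (hg : MemLp g 2 volume)
    (hf' : MemLp f' 2 volume) (hg' : MemLp g' 2 volume) :
    HasFourierDeriv θ (fun t => f t * g t) fun t => f' t * g t + f t * g' t := by
  intro n
  rw [mFourierCoeff_add (integrable_mul_of_memLp_two hf' hg) (integrable_mul_of_memLp_two hf hg')]
  refine ((hasSum_mFourierCoeff_mul hf' hg n).add (hasSum_mFourierCoeff_mul hf hg' n)).unique ?_
  convert! (hasSum_mFourierCoeff_mul hf hg n).mul_left (θ n) using 2 with m
  rw [h, k, map_sub]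
  ring

theorem HasFourierDeriv.conj (h : HasFourierDeriv θ f f') (hθ : ∀ n, conj (θ n) = -θ n) :
    HasFourierDeriv θ (fun t => conj (f t)) fun t => conj (f' t) := by
  intro n
  rw [mFourierCoeff_conj, mFourierCoeff_conj, h, map_mul, hθ, map_neg, neg_neg]

theorem HasFourierDeriv.sum (s : Finset κ) {F F' : κ → UnitAddTorus ι → ℂ}
    (h : ∀ i ∈ s, HasFourierDeriv θ (F i) (F' i))
    (hF : ∀ i ∈ s, Integrable (F i)) (hF' : ∀ i ∈ s, Integrable (F' i)) :
    HasFourierDeriv θ (fun t => ∑ i ∈ s, F i t) fun t => ∑ i ∈ s, F' i t := by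
  intro n
  rw [mFourierCoeff_sum s hF, mFourierCoeff_sum s hF', Finset.mul_sum]
  exact Finset.sum_congr rfl fun i hi => h i hi n

theorem HasFourierDeriv.ae_eq {f'' : UnitAddTorus ι → ℂ} (h : HasFourierDeriv θ f f')
    (k : HasFourierDeriv θ f f'') (hf' : MemLp f' 2 volume) (hf'' : MemLp f'' 2 volume) :
    f' =ᵐ[volume] f'' :=
  ae_eq_of_mFourierCoeff_eq hf' hf'' fun n => (h n).trans (k n).symm

/-- `∂₁(u v₂) - ∂₂(u v₁) = u₁ v₂ - u₂ v₁` when subscripts denote derivatives. -/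
theorem mFourierCoeff_curl_mul {θ₁ θ₂ : (ι → ℤ) →+ ℂ} {u u₁ u₂ v v₁ v₂ : UnitAddTorus ι → ℂ}
    (hu : MemLp u 2 volume) (hu₁ : MemLp u₁ 2 volume) (hu₂ : MemLp u₂ 2 volume)
    (hv₁ : MemLp v₁ 2 volume) (hv₂ : MemLp v₂ 2 volume)
    (h₁ : HasFourierDeriv θ₁ u u₁) (h₂ : HasFourierDeriv θ₂ u u₂)
    (k₁ : HasFourierDeriv θ₁ v v₁) (k₂ : HasFourierDeriv θ₂ v v₂) (n : ι → ℤ) :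
    θ₁ n * mFourierCoeff (fun t => u t * v₂ t) n - θ₂ n * mFourierCoeff (fun t => u t * v₁ t) n =
      mFourierCoeff (fun t => u₁ t * v₂ t) n - mFourierCoeff (fun t => u₂ t * v₁ t) n := by
  refine HasSum.unique (((hasSum_mFourierCoeff_mul hu hv₂ n).mul_left (θ₁ n)).sub
    ((hasSum_mFourierCoeff_mul hu hv₁ n).mul_left (θ₂ n))) ?_
  convert! (hasSum_mFourierCoeff_mul hu₁ hv₂ n).sub (hasSum_mFourierCoeff_mul hu₂ hv₁ n)
    using 2 with m
  rw [h₁, h₂, k₁, k₂, map_sub, map_sub]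
  ring

variable [Fintype κ] {Θ : κ → (ι → ℤ) →+ ℂ} {F F₁ F₂ : UnitAddTorus ι → ℂ}
  {G G₁ G₂ : κ → UnitAddTorus ι → ℂ}

/-- The vector field `G` has weak divergence `F`, the derivative in the `j`-th direction having
Fourier symbol `Θ j`. -/
def HasFourierDiv (Θ : κ → (ι → ℤ) →+ ℂ) (G : κ → UnitAddTorus ι → ℂ) (F : UnitAddTorus ι → ℂ) :
    Prop :=
  ∀ n, ∑ j, Θ j n * mFourierCoeff (G j) n = mFourierCoeff F n

theorem HasFourierDiv.congr_ae (h : HasFourierDiv Θ G F₁) (hF : F₁ =ᵐ[volume] F₂) :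
    HasFourierDiv Θ G F₂ :=
  fun n => (h n).trans (mFourierCoeff_congr_ae hF n)

theorem HasFourierDiv.add (h₁ : HasFourierDiv Θ G₁ F₁) (h₂ : HasFourierDiv Θ G₂ F₂)
    (hG₁ : ∀ j, Integrable (G₁ j)) (hG₂ : ∀ j, Integrable (G₂ j)) (hF₁ : Integrable F₁)
    (hF₂ : Integrable F₂) :
    HasFourierDiv Θ (fun j t => G₁ j t + G₂ j t) fun t => F₁ t + F₂ t := by
  intro n
  simp only [mFourierCoeff_add (hG₁ _) (hG₂ _), mFourierCoeff_add hF₁ hF₂, ← h₁ n, ← h₂ n, mul_add,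
    Finset.sum_add_distrib]

theorem HasFourierDiv.sum {σ : Type*} (s : Finset σ) {G : σ → κ → UnitAddTorus ι → ℂ}
    {F : σ → UnitAddTorus ι → ℂ} (h : ∀ i ∈ s, HasFourierDiv Θ (G i) (F i))
    (hG : ∀ i ∈ s, ∀ j, Integrable (G i j)) (hF : ∀ i ∈ s, Integrable (F i)) :
    HasFourierDiv Θ (fun j t => ∑ i ∈ s, G i j t) fun t => ∑ i ∈ s, F i t := by
  intro n
  simp only [mFourierCoeff_sum s fun i hi => hG i hi _, mFourierCoeff_sum s hF, Finset.mul_sum]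
  rw [Finset.sum_comm]
  exact Finset.sum_congr rfl fun i hi => h i hi n

theorem hasFourierDiv_of_hasFourierDeriv {H : κ → UnitAddTorus ι → ℂ}
    (h : ∀ j, HasFourierDeriv (Θ j) (G j) (H j)) (hH : ∀ j, Integrable (H j)) :
    HasFourierDiv Θ G fun t => ∑ j, H j t := by
  intro n
  rw [mFourierCoeff_sum _ fun j _ => hH j]
  exact Finset.sum_congr rfl fun j _ => (h j n).symm

end FourierDerivatives

/-! ### Fejér means and the product rule for bounded functions -/

section Fejer

open scoped Pointwise

variable {ι : Type*} [Fintype ι] {f g : UnitAddTorus ι → ℂ}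

/-- The Fejér mean of `f` attached to a finite set `S` of frequencies: the partial Fourier series
over `S - S` in which each frequency is weighted by its number of representations, divided by the
cardinality of `S`. For any `S` the kernel is nonnegative, which is why the frequencies are
arranged in this way. -/
def fejer (S : Finset (ι → ℤ)) (f : UnitAddTorus ι → ℂ) (x : UnitAddTorus ι) : ℂ :=
  (S.card : ℂ)⁻¹ * ∑ p ∈ S ×ˢ S, mFourierCoeff f (p.1 - p.2) * mFourier (p.1 - p.2) x

/-- The kernel of the Fejér mean attached to `S`. -/
def fejerKernel (S : Finset (ι → ℤ)) (x t : UnitAddTorus ι) : ℝ :=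
  (S.card : ℝ)⁻¹ * ‖∑ k ∈ S, mFourier k x * mFourier (-k) t‖ ^ 2

theorem continuous_fejer (S : Finset (ι → ℤ)) (f : UnitAddTorus ι → ℂ) :
    Continuous (fejer S f) := by
  unfold fejer
  fun_prop

theorem memLp_fejer (S : Finset (ι → ℤ)) (f : UnitAddTorus ι → ℂ) {p : ENNReal} :
    MemLp (fejer S f) p volume := by
  obtain ⟨C, hC⟩ := (isCompact_univ (X := UnitAddTorus ι)).exists_bound_of_continuousOn
    (continuous_fejer S f).continuousOn
  exact MemLp.of_bound (continuous_fejer S f).aestronglyMeasurable C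
    (Eventually.of_forall fun t => hC t (mem_univ t))

theorem fejerKernel_nonneg (S : Finset (ι → ℤ)) (x t : UnitAddTorus ι) : 0 ≤ fejerKernel S x t := by
  unfold fejerKernel
  positivity

theorem fejerKernel_eq_sum (S : Finset (ι → ℤ)) (x t : UnitAddTorus ι) :
    (fejerKernel S x t : ℂ) =
      (S.card : ℂ)⁻¹ * ∑ p ∈ S ×ˢ S, mFourier (p.1 - p.2) x * mFourier (-(p.1 - p.2)) t := by
  unfold fejerKernel
  push_cast
  rw [← Complex.mul_conj', map_sum, Finset.sum_mul_sum, ← Finset.sum_product']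
  congr 1
  refine Finset.sum_congr rfl fun p _ => ?_
  rw [map_mul, ← mFourier_neg, ← mFourier_neg, neg_neg, sub_eq_add_neg, mFourier_add, neg_add,
    mFourier_add, neg_neg]
  ring

theorem fejer_eq_integral (S : Finset (ι → ℤ)) (hf : Integrable f) (x : UnitAddTorus ι) :
    fejer S f x = ∫ t, (fejerKernel S x t : ℂ) * f t := by
  simp only [fejerKernel_eq_sum, mul_assoc, Finset.sum_mul]
  rw [integral_const_mul, integral_finsetSum]
  · simp only [integral_const_mul, ← mFourierCoeff_eq_integral_mul, fejer,
      mul_comm (mFourierCoeff f _)]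
  · exact fun p _ => (integrable_mFourier_mul _ hf).const_mul _

theorem integrable_fejerKernel (S : Finset (ι → ℤ)) (x : UnitAddTorus ι) :
    Integrable (fejerKernel S x) := by
  refine Continuous.integrable_of_hasCompactSupport ?_ (HasCompactSupport.of_compactSpace _)
  unfold fejerKernel
  fun_prop

theorem integral_fejerKernel {S : Finset (ι → ℤ)} (hS : S.Nonempty) (x : UnitAddTorus ι) :
    ∫ t, fejerKernel S x t = 1 := by
  have hcard : (S.card : ℂ) ≠ 0 := by exact_mod_cast hS.card_pos.ne'
  have hfejer_one : fejer S (fun _ => 1) x = 1 := by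
    simp only [fejer, mFourierCoeff_one, sub_eq_zero, ite_mul, one_mul, zero_mul]
    rw [← Finset.sum_filter, ← Finset.diag_eq_filter, Finset.sum_diag]
    simp [mFourier_zero, hcard]
  have h := fejer_eq_integral S (integrable_const (1 : ℂ)) x
  simp only [hfejer_one, mul_one] at h
  rw [integral_complex_ofReal] at h
  exact_mod_cast h.symm

theorem norm_fejer_le {S : Finset (ι → ℤ)} (hS : S.Nonempty) (hf : Integrable f) {C : ℝ}
    (hC : ∀ᵐ t, ‖f t‖ ≤ C) (x : UnitAddTorus ι) : ‖fejer S f x‖ ≤ C := by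
  rw [fejer_eq_integral S hf x]
  calc ‖∫ t, (fejerKernel S x t : ℂ) * f t‖ ≤ ∫ t, fejerKernel S x t * C := by
        refine norm_integral_le_of_norm_le ((integrable_fejerKernel S x).mul_const C) ?_
        filter_upwards [hC] with t ht
        rw [norm_mul, Complex.norm_real, Real.norm_of_nonneg (fejerKernel_nonneg S x t)]
        exact mul_le_mul_of_nonneg_left ht (fejerKernel_nonneg S x t)
    _ = C := by rw [integral_mul_const, integral_fejerKernel hS, one_mul]

theorem mFourierCoeff_fejer_mul (S : Finset (ι → ℤ)) (f : UnitAddTorus ι → ℂ) (hg : Integrable g)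
    (n : ι → ℤ) :
    mFourierCoeff (fun t => fejer S f t * g t) n = (S.card : ℂ)⁻¹ *
      ∑ p ∈ S ×ˢ S, mFourierCoeff f (p.1 - p.2) * mFourierCoeff g (n - (p.1 - p.2)) := by
  simp only [fejer, mul_assoc, Finset.sum_mul]
  rw [mFourierCoeff_const_mul,
    mFourierCoeff_sum _ fun p _ => (integrable_mFourier_mul _ hg).const_mul _]
  simp only [mFourierCoeff_const_mul, mFourierCoeff_mFourier_mul]

/-- The factor by which the Fejér mean attached to `S` multiplies the `n`-th Fourier coefficient:
the number of representations of `n` as a difference in `S`, divided by the cardinality of `S`. -/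
def fejerWeight (S : Finset (ι → ℤ)) (n : ι → ℤ) : ℝ :=
  (S.card : ℝ)⁻¹ * S.addConvolution (-S) n

theorem mFourierCoeff_fejer (S : Finset (ι → ℤ)) (f : UnitAddTorus ι → ℂ) (n : ι → ℤ) :
    mFourierCoeff (fejer S f) n = fejerWeight S n * mFourierCoeff f n := by
  have h := mFourierCoeff_fejer_mul S f (integrable_const (1 : ℂ)) n
  simp only [mul_one, mFourierCoeff_one, sub_eq_zero, mul_ite, mul_zero] at h
  have hcount : ∑ p ∈ S ×ˢ S, (if n = p.1 - p.2 then mFourierCoeff f (p.1 - p.2) else 0) =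
      S.addConvolution (-S) n * mFourierCoeff f n := by
    rw [← Finset.sum_filter, ← Finset.card_add_neg_eq_addConvolution_neg, ← nsmul_eq_mul,
      Finset.sum_congr (g := fun _ => mFourierCoeff f n) rfl fun p hp => by
        rw [← (Finset.mem_filter.mp hp).2]]
    simp only [Finset.sum_const, eq_comm (a := n), sub_eq_add_neg]
  refine h.trans ?_
  rw [hcount, fejerWeight]
  push_cast
  ring

theorem fejerWeight_nonneg (S : Finset (ι → ℤ)) (n : ι → ℤ) : 0 ≤ fejerWeight S n := by
  unfold fejerWeight
  positivity

theorem fejerWeight_le_one (S : Finset (ι → ℤ)) (n : ι → ℤ) : fejerWeight S n ≤ 1 := by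
  have h : (S.addConvolution (-S) n : ℝ) ≤ S.card := by
    exact_mod_cast Finset.addConvolution_le_card_left
  exact (mul_le_mul_of_nonneg_left h (by positivity)).trans inv_mul_le_one

theorem tendsto_mFourierCoeff_mul_of_ae_tendsto {F : ℕ → UnitAddTorus ι → ℂ} {C : ℝ}
    (hF : ∀ i, AEStronglyMeasurable (F i)) (hC : ∀ i, ∀ᵐ t, ‖F i t‖ ≤ C)
    (hlim : ∀ᵐ t, Tendsto (fun i => F i t) atTop (𝓝 (f t))) (hg : Integrable g) (n : ι → ℤ) :
    Tendsto (fun i => mFourierCoeff (fun t => F i t * g t) n) atTop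
      (𝓝 (mFourierCoeff (fun t => f t * g t) n)) := by
  simp only [mFourierCoeff_eq_integral_mul]
  refine tendsto_integral_of_dominated_convergence (fun t => C * ‖g t‖)
    (fun i => (aestronglyMeasurable_mFourier _).mul ((hF i).mul hg.1)) (hg.norm.const_mul C)
    (fun i => ?_) ?_
  · filter_upwards [hC i] with t ht
    rw [norm_mul, norm_mFourier_apply, one_mul, norm_mul]
    gcongr
  · filter_upwards [hlim] with t ht
    exact (ht.mul_const _).const_mul _

variable [DecidableEq ι]

/-- The discrete box `[0, N]^ι`. -/
def box (ι : Type*) [Fintype ι] [DecidableEq ι] (N : ℕ) : Finset (ι → ℤ) :=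
  Finset.Icc 0 (fun _ => (N : ℤ))

theorem box_nonempty (N : ℕ) : (box ι N).Nonempty :=
  ⟨0, Finset.mem_Icc.mpr ⟨le_rfl, fun _ => Int.natCast_nonneg N⟩⟩

theorem addConvolution_box_neg_box (N : ℕ) (n : ι → ℤ) :
    (box ι N).addConvolution (-box ι N) n = ∏ i, ((N : ℤ) + 1 - |n i|).toNat := by
  have htranslate : n +ᵥ box ι N = Finset.Icc n (n + fun _ => (N : ℤ)) := by
    rw [box, ← Finset.image_vadd]
    simpa using Finset.image_add_left_Icc (0 : ι → ℤ) (fun _ => (N : ℤ)) n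
  have hinter : box ι N ∩ Finset.Icc n (n + fun _ => (N : ℤ)) =
      Finset.Icc (0 ⊔ n) ((fun _ => (N : ℤ)) ⊓ (n + fun _ => (N : ℤ))) := by
    rw [box, ← Finset.coe_inj, Finset.coe_inter, Finset.coe_Icc, Finset.coe_Icc, Finset.coe_Icc,
      Set.Icc_inter_Icc]
  rw [← Finset.card_inter_vadd, htranslate, hinter, Pi.card_Icc]
  refine Finset.prod_congr rfl fun i _ => ?_
  simp only [Int.card_Icc, Pi.sup_apply, Pi.inf_apply, Pi.add_apply, Pi.zero_apply]
  congr 1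
  rcases abs_cases (n i) with ⟨h, _⟩ | ⟨h, _⟩ <;> omega

theorem fejerWeight_box (N : ℕ) (n : ι → ℤ) :
    fejerWeight (box ι N) n = ∏ i, ((((N : ℤ) + 1 - |n i|).toNat : ℝ) / (N + 1)) := by
  have hcard : ((box ι N).card : ℝ) = ∏ _i : ι, ((N : ℝ) + 1) := by
    simp [box, Pi.card_Icc]
  rw [fejerWeight, hcard, addConvolution_box_neg_box, Finset.prod_div_distrib, Nat.cast_prod,
    inv_mul_eq_div]

theorem tendsto_fejerWeight (n : ι → ℤ) :
    Tendsto (fun N => fejerWeight (box ι N) n) atTop (𝓝 1) := by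
  simp only [fejerWeight_box]
  suffices Tendsto (fun N : ℕ => ∏ i, ((((N : ℤ) + 1 - |n i|).toNat : ℝ) / (N + 1))) atTop
      (𝓝 (∏ _i : ι, 1)) by simpa only [Finset.prod_const_one] using this
  refine tendsto_finsetProd _ fun i _ => ?_
  have hlim : Tendsto (fun N : ℕ => 1 - |(n i : ℝ)| / ((N : ℝ) + 1)) atTop (𝓝 (1 - 0)) :=
    tendsto_const_nhds.sub (tendsto_const_nhds.div_atTop
      (tendsto_atTop_add_const_right _ _ tendsto_natCast_atTop_atTop))
  rw [sub_zero] at hlim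
  refine hlim.congr' ?_
  filter_upwards [eventually_ge_atTop (n i).natAbs] with N hN
  have hcast : (((N : ℤ) + 1 - |n i|).toNat : ℤ) = N + 1 - |n i| :=
    Int.toNat_of_nonneg (by rw [Int.abs_eq_natAbs]; omega)
  have hcast' : (((N : ℤ) + 1 - |n i|).toNat : ℝ) = N + 1 - |(n i : ℝ)| := by exact_mod_cast hcast
  have hN0 : (N : ℝ) + 1 ≠ 0 := by positivity
  rw [hcast', sub_div, div_self hN0]

theorem tendsto_toLp_fejer (hf : MemLp f 2 volume) :
    Tendsto (fun N => (memLp_fejer (box ι N) f).toLp (fejer (box ι N) f)) atTop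
      (𝓝 (hf.toLp f)) := by
  have hparseval (N : ℕ) := hasSum_norm_sq_mFourierCoeff
    ((memLp_fejer (p := 2) (box ι N) f).toLp (fejer (box ι N) f) - hf.toLp f)
  have hcoeff (N : ℕ) (n : ι → ℤ) :
      mFourierCoeff ⇑((memLp_fejer (p := 2) (box ι N) f).toLp (fejer (box ι N) f) - hf.toLp f) n =
        (fejerWeight (box ι N) n - 1 : ℝ) * mFourierCoeff f n := by
    rw [← MemLp.toLp_sub, mFourierCoeff_coeFn_toLp]
    refine (mFourierCoeff_sub ((memLp_fejer _ _).integrable one_le_two)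
      (hf.integrable one_le_two) n).trans ?_
    rw [mFourierCoeff_fejer]
    push_cast
    ring
  have hzero : ∑' n, ‖((0 : ℝ) : ℂ) * mFourierCoeff f n‖ ^ 2 = 0 := by simp
  have hsq : Tendsto (fun N => ‖(memLp_fejer (box ι N) f).toLp (fejer (box ι N) f) -
      hf.toLp f‖ ^ 2) atTop (𝓝 0) := by
    simp only [← (hparseval _).tsum_eq, hcoeff]
    rw [← hzero]
    refine tendsto_tsum_of_dominated_convergence (hasSum_norm_sq_mFourierCoeff (hf.toLp f)).summable
      (fun n => ?_) (Eventually.of_forall fun N n => ?_)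
    · have hweight := (tendsto_fejerWeight n).sub_const 1
      rw [sub_self] at hweight
      exact (((Complex.continuous_ofReal.tendsto 0).comp hweight).mul_const _).norm.pow 2
    · have hle : |fejerWeight (box ι N) n - 1| ≤ 1 := by
        rw [abs_le]
        constructor <;>
          linarith [fejerWeight_nonneg (box ι N) n, fejerWeight_le_one (box ι N) n]
      rw [norm_pow, norm_norm, norm_mul, Complex.norm_real, mFourierCoeff_coeFn_toLp]
      gcongr
      exact mul_le_of_le_one_left (norm_nonneg _) hle
  rw [tendsto_iff_norm_sub_tendsto_zero]
  simpa using hsq.sqrt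

theorem tendsto_mFourierCoeff_fejer_mul (hf : MemLp f 2 volume) (hg : MemLp g 2 volume)
    (n : ι → ℤ) :
    Tendsto (fun N => mFourierCoeff (fun t => fejer (box ι N) f t * g t) n) atTop
      (𝓝 (mFourierCoeff (fun t => f t * g t) n)) := by
  simp only [mFourierCoeff_mul_eq_inner hf hg, mFourierCoeff_mul_eq_inner (memLp_fejer _ f) hg]
  exact tendsto_const_nhds.inner (tendsto_toLp_fejer hf)

theorem exists_seq_tendsto_fejer_ae (hf : MemLp f 2 volume) :
    ∃ N : ℕ → ℕ, StrictMono N ∧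
      ∀ᵐ t, Tendsto (fun i => fejer (box ι (N i)) f t) atTop (𝓝 (f t)) := by
  obtain ⟨N, hN, hlim⟩ :=
    (tendstoInMeasure_of_tendsto_Lp (tendsto_toLp_fejer hf)).exists_seq_tendsto_ae
  have hfejer : ∀ᵐ t, ∀ i, (memLp_fejer (p := 2) (box ι (N i)) f).toLp _ t =
      fejer (box ι (N i)) f t :=
    ae_all_iff.mpr fun i => MemLp.coeFn_toLp _
  refine ⟨N, hN, ?_⟩
  filter_upwards [hlim, hfejer, hf.coeFn_toLp] with t hlim_t hfejer_t hf_t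
  simpa only [hfejer_t, hf_t] using hlim_t

end Fejer

section ProductRule

variable {ι κ : Type*} [Fintype ι] [Fintype κ] {Θ : κ → (ι → ℤ) →+ ℂ} {u F : UnitAddTorus ι → ℂ}
  {Du G : κ → UnitAddTorus ι → ℂ}

theorem exists_ae_norm_le_of_memLp_top {α E : Type*} [MeasurableSpace α] [NormedAddCommGroup E]
    {μ : Measure α} {f : α → E} (hf : MemLp f ⊤ μ) : ∃ C, ∀ᵐ t ∂μ, ‖f t‖ ≤ C := by
  have hfinite : eLpNormEssSup f μ < ⊤ := eLpNorm_exponent_top (f := f) ▸ hf.2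
  refine ⟨(eLpNormEssSup f μ).toReal, (ae_le_eLpNormEssSup (f := f)).mono fun t ht => ?_⟩
  simpa using ENNReal.toReal_mono hfinite.ne ht

theorem HasFourierDiv.fejer_mul (h : HasFourierDiv Θ G F) (S : Finset (ι → ℤ))
    (hu : ∀ j, HasFourierDeriv (Θ j) u (Du j)) (hG : ∀ j, Integrable (G j)) (hF : Integrable F)
    (n : ι → ℤ) :
    ∑ j, Θ j n * mFourierCoeff (fun t => fejer S u t * G j t) n =
      mFourierCoeff (fun t => fejer S u t * F t) n +
        ∑ j, mFourierCoeff (fun t => fejer S (Du j) t * G j t) n := by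
  simp only [mFourierCoeff_fejer_mul _ _ (hG _), mFourierCoeff_fejer_mul _ _ hF, ← h _, hu _ _,
    Finset.mul_sum]
  rw [Finset.sum_comm, Finset.sum_comm (s := (Finset.univ : Finset κ)) (t := S ×ˢ S),
    ← Finset.sum_add_distrib]
  refine Finset.sum_congr rfl fun p _ => ?_
  rw [← Finset.sum_add_distrib]
  refine Finset.sum_congr rfl fun j _ => ?_
  have hsplit : Θ j n = Θ j (p.1 - p.2) + Θ j (n - (p.1 - p.2)) := by
    rw [← map_add, add_sub_cancel]
  rw [hsplit]
  ring

/-- Fejér means make this work for `F` merely integrable: they preserve the bound on `u`, so that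
`fejer u * F` converges by dominated convergence. -/
theorem HasFourierDiv.mul_of_bounded (h : HasFourierDiv Θ G F) (hu : MemLp u ⊤ volume)
    (hDu : ∀ j, MemLp (Du j) 2 volume) (hderiv : ∀ j, HasFourierDeriv (Θ j) u (Du j))
    (hG : ∀ j, MemLp (G j) 2 volume) (hF : Integrable F) :
    HasFourierDiv Θ (fun j t => u t * G j t) fun t => u t * F t + ∑ j, Du j t * G j t := by
  classical
  intro n
  obtain ⟨C, hC⟩ := exists_ae_norm_le_of_memLp_top hu
  have hu2 : MemLp u 2 volume := hu.mono_exponent le_top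
  obtain ⟨N, hN, hlim⟩ := exists_seq_tendsto_fejer_ae hu2
  have hlim_F := tendsto_mFourierCoeff_mul_of_ae_tendsto
    (fun i => (continuous_fejer (box ι (N i)) u).aestronglyMeasurable)
    (fun i => Eventually.of_forall
      (norm_fejer_le (box_nonempty (N i)) (hu2.integrable one_le_two) hC)) hlim hF n
  have hlim_Du (j : κ) :=
    (tendsto_mFourierCoeff_fejer_mul (hDu j) (hG j) n).comp hN.tendsto_atTop
  have hlim_G (j : κ) :=
    ((tendsto_mFourierCoeff_fejer_mul hu2 (hG j) n).comp hN.tendsto_atTop).const_mul (Θ j n)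
  have hDuG (j : κ) : Integrable fun t => Du j t * G j t :=
    integrable_mul_of_memLp_two (hDu j) (hG j)
  rw [mFourierCoeff_add (hF.bdd_mul hu.1 hC) (integrable_finsetSum _ fun j _ => hDuG j),
    mFourierCoeff_sum _ fun j _ => hDuG j]
  refine tendsto_nhds_unique (tendsto_finsetSum _ fun j _ => hlim_G j)
    ((hlim_F.add (tendsto_finsetSum _ fun j _ => hlim_Du j)).congr fun i => ?_)
  exact (h.fejer_mul _ hderiv (fun j => (hG j).integrable one_le_two) hF n).symm

end ProductRule

/-! ### Exponential decay -/

section Decay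

section Summability

variable {ι : Type*} [Fintype ι]

theorem summable_prod_apply_of_nonneg {α : Type*} {g : α → ℝ} (hg : ∀ k, 0 ≤ g k)
    (hs : Summable g) : Summable fun n : ι → α => ∏ i, g (n i) := by
  classical
  refine summable_of_sum_le (c := ∏ _i : ι, ∑' k, g k)
    (fun n => Finset.prod_nonneg fun i _ => hg _) fun u => ?_
  calc ∑ n ∈ u, ∏ i, g (n i)
      ≤ ∑ n ∈ Fintype.piFinset fun i => u.image fun n => n i, ∏ i, g (n i) :=
        Finset.sum_le_sum_of_subset_of_nonneg
          (fun n hn => Fintype.mem_piFinset.mpr fun i => Finset.mem_image_of_mem _ hn)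
          fun n _ _ => Finset.prod_nonneg fun i _ => hg _
    _ = ∏ i, ∑ k ∈ u.image fun n => n i, g k := (Finset.prod_univ_sum _ _).symm
    _ ≤ ∏ _i : ι, ∑' k, g k :=
        Finset.prod_le_prod (fun i _ => Finset.sum_nonneg fun k _ => hg k)
          fun i _ => hs.sum_le_tsum _ fun k _ => hg k

theorem summable_exp_neg_mul_norm_int {δ : ℝ} (hδ : 0 < δ) :
    Summable fun k : ℤ => Real.exp (-(δ * ‖k‖)) := by
  have hnat : Summable fun k : ℕ => Real.exp (-(δ * (k : ℝ))) :=
    (Real.summable_exp_nat_mul_iff.mpr (neg_neg_of_pos hδ)).congr fun k => by congr 1; ring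
  exact Summable.of_nat_of_neg (by simpa using hnat) (by simpa using hnat)

theorem summable_exp_neg_mul_norm {ε : ℝ} (hε : 0 < ε) :
    Summable fun n : ι → ℤ => Real.exp (-(ε * ‖n‖)) := by
  set δ : ℝ := ε / (Fintype.card ι + 1) with hδ
  have hδ0 : 0 < δ := by positivity
  refine Summable.of_nonneg_of_le (fun n => (Real.exp_pos _).le) (fun n => ?_)
    (summable_prod_apply_of_nonneg (fun _ => (Real.exp_pos _).le)
      (summable_exp_neg_mul_norm_int hδ0))
  rw [← Real.exp_sum, Real.exp_le_exp, Finset.sum_neg_distrib, neg_le_neg_iff, ← Finset.mul_sum]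
  have hsum : ∑ i, ‖n i‖ ≤ Fintype.card ι * ‖n‖ := by
    simpa using Pi.sum_norm_apply_le_norm n
  calc δ * ∑ i, ‖n i‖ ≤ δ * ((Fintype.card ι + 1) * ‖n‖) := by
        gcongr
        exact hsum.trans (by gcongr; linarith)
    _ = ε * ‖n‖ := by rw [hδ]; field_simp

end Summability

/-- Exponential decay of a family `a` of vectors: `‖a n‖ ≤ C exp (-ε ‖n‖)` for some `ε > 0`. -/
def ExpDecay {G F : Type*} [Norm G] [Norm F] (a : G → F) : Prop :=
  ∃ C ε : ℝ, 0 ≤ C ∧ 0 < ε ∧ ∀ n, ‖a n‖ ≤ C * Real.exp (-(ε * ‖n‖))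

namespace ExpDecay

variable {G F F' : Type*} [SeminormedAddCommGroup G] [SeminormedAddCommGroup F]
  [SeminormedAddCommGroup F']

theorem of_norm_le {a : G → F} {b : G → F'} (ha : ExpDecay a) {K : ℝ} (h : ∀ n, ‖b n‖ ≤ K * ‖a n‖) :
    ExpDecay b := by
  obtain ⟨C, ε, hC, hε, H⟩ := ha
  refine ⟨|K| * C, ε, by positivity, hε, fun n => (h n).trans ?_⟩
  rw [mul_assoc]
  exact mul_le_mul (le_abs_self K) (H n) (norm_nonneg _) (abs_nonneg K)

theorem exists_common {κ : Type*} [Finite κ] {a : κ → G → F} (ha : ∀ i, ExpDecay (a i)) :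
    ∃ C ε : ℝ, 0 ≤ C ∧ 0 < ε ∧ ∀ i n, ‖a i n‖ ≤ C * Real.exp (-(ε * ‖n‖)) := by
  choose C ε hC hε H using ha
  cases nonempty_fintype κ
  obtain ⟨ε₀, hε₀, hle⟩ : ∃ ε₀ > 0, ∀ i, ε₀ ≤ ε i := by
    rcases isEmpty_or_nonempty κ with hκ | hκ
    · exact ⟨1, one_pos, hκ.elim⟩
    · obtain ⟨i₀, hi₀⟩ := Finite.exists_min ε
      exact ⟨ε i₀, hε i₀, hi₀⟩
  refine ⟨∑ i, C i, ε₀, Finset.sum_nonneg fun i _ => hC i, hε₀, fun i n => (H i n).trans ?_⟩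
  gcongr
  · exact Finset.sum_nonneg fun i _ => hC i
  · exact Finset.single_le_sum (f := C) (fun i _ => hC i) (Finset.mem_univ i)
  · exact hle i

theorem sum {κ : Type*} [Fintype κ] {a : κ → G → F} (ha : ∀ i, ExpDecay (a i)) :
    ExpDecay fun n => ∑ i, a i n := by
  obtain ⟨C, ε, hC, hε, H⟩ := exists_common ha
  refine ⟨Fintype.card κ * C, ε, by positivity, hε, fun n => ?_⟩
  simpa [mul_assoc] using norm_sum_le_of_le Finset.univ fun i _ => H i n

theorem add {a b : G → F} (ha : ExpDecay a) (hb : ExpDecay b) : ExpDecay fun n => a n + b n := by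
  simpa using ExpDecay.sum (a := ![a, b]) (by simp [Fin.forall_fin_two, ha, hb])

theorem of_finite_support {a : G → F} {s : Finset G} (h : ∀ n ∉ s, a n = 0) : ExpDecay a := by
  refine ⟨∑ n ∈ s, ‖a n‖ * Real.exp ‖n‖, 1, by positivity, one_pos, fun n => ?_⟩
  by_cases hn : n ∈ s
  · rw [one_mul, Real.exp_neg, ← div_eq_mul_inv, le_div_iff₀ (Real.exp_pos _)]
    exact Finset.single_le_sum (f := fun n => ‖a n‖ * Real.exp ‖n‖)
      (fun i _ => by positivity) hn
  · rw [h n hn, norm_zero]; positivity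

theorem of_pow_mul_le {a : G → F} {C ρ : ℝ} (hρ : 0 < ρ)
    (h : ∀ n q, ‖n‖ ^ q * ‖a n‖ ≤ C * q.factorial * ρ ^ q) : ExpDecay a := by
  refine ⟨2 * |C|, 1 / (2 * ρ), by positivity, by positivity, fun n => ?_⟩
  have hexp := NormedSpace.exp_series_hasSum_exp' (𝕂 := ℝ) (1 / (2 * ρ) * ‖n‖)
  rw [← Real.exp_eq_exp_ℝ] at hexp
  have hle : ‖a n‖ * Real.exp (1 / (2 * ρ) * ‖n‖) ≤ C * 2 := by
    refine hasSum_le (fun q => ?_) (hexp.mul_left ‖a n‖) (hasSum_geometric_two.mul_left C)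
    calc ‖a n‖ * ((q.factorial : ℝ)⁻¹ • (1 / (2 * ρ) * ‖n‖) ^ q)
        = ‖n‖ ^ q * ‖a n‖ * ((1 / (2 * ρ)) ^ q / q.factorial) := by
          rw [smul_eq_mul, mul_pow]; ring
      _ ≤ C * q.factorial * ρ ^ q * ((1 / (2 * ρ)) ^ q / q.factorial) :=
          mul_le_mul_of_nonneg_right (h n q) (by positivity)
      _ = C * (1 / 2) ^ q := by
          rw [div_pow, div_pow, mul_pow]; field_simp
  rw [Real.exp_neg, ← div_eq_mul_inv, le_div_iff₀ (Real.exp_pos _)]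
  linarith [le_abs_self C]

theorem summable_norm {ι : Type*} [Fintype ι] {a : (ι → ℤ) → F} (ha : ExpDecay a) :
    Summable fun n => ‖a n‖ := by
  obtain ⟨C, ε, -, hε, H⟩ := ha
  exact Summable.of_nonneg_of_le (fun _ => norm_nonneg _) H
    ((summable_exp_neg_mul_norm hε).mul_left C)

end ExpDecay

section Convolution

variable {G : Type*} [SeminormedAddCommGroup G]

theorem min_exp_norm_le_mul {δ R : ℝ} (hδ : 0 ≤ δ) (hR : 0 ≤ R) (n m : G) :
    min (Real.exp (δ * ‖n‖)) R ≤ Real.exp (δ * ‖m‖) * min (Real.exp (δ * ‖n - m‖)) R := by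
  have hone : 1 ≤ Real.exp (δ * ‖m‖) := Real.one_le_exp (by positivity)
  rw [mul_min_of_nonneg _ _ (Real.exp_pos _).le]
  refine min_le_min ?_ (le_mul_of_one_le_left hR hone)
  rw [← Real.exp_add, Real.exp_le_exp, ← mul_add]
  gcongr
  simpa using norm_add_le m (n - m)

theorem min_exp_mul_tsum_le {b k : G → ℝ} {δ R S : ℝ} (hδ : 0 ≤ δ) (hR : 1 ≤ R)
    (hb : ∀ n, 0 ≤ b n) (hk : ∀ n, 0 ≤ k n) (hsum : Summable fun m => Real.exp (δ * ‖m‖) * k m)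
    (hS : ∀ n, min (Real.exp (δ * ‖n‖)) R * b n ≤ S) (n : G) :
    min (Real.exp (δ * ‖n‖)) R * ∑' m, k m * b (n - m) ≤
      (∑' m, Real.exp (δ * ‖m‖) * k m) * S := by
  have hterm (m : G) : min (Real.exp (δ * ‖n‖)) R * (k m * b (n - m)) ≤
      Real.exp (δ * ‖m‖) * k m * S :=
    calc min (Real.exp (δ * ‖n‖)) R * (k m * b (n - m))
        ≤ (Real.exp (δ * ‖m‖) * min (Real.exp (δ * ‖n - m‖)) R) * (k m * b (n - m)) :=
          mul_le_mul_of_nonneg_right (min_exp_norm_le_mul hδ (by linarith) n m)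
            (mul_nonneg (hk m) (hb _))
      _ = Real.exp (δ * ‖m‖) * k m * (min (Real.exp (δ * ‖n - m‖)) R * b (n - m)) := by ring
      _ ≤ Real.exp (δ * ‖m‖) * k m * S :=
          mul_le_mul_of_nonneg_left (hS _) (mul_nonneg (Real.exp_pos _).le (hk m))
  have hR0 : 0 ≤ min (Real.exp (δ * ‖n‖)) R := le_min (Real.exp_pos _).le (by linarith)
  rw [← tsum_mul_left, ← tsum_mul_right]
  exact Summable.tsum_le_tsum hterm
    (Summable.of_nonneg_of_le (fun m => mul_nonneg hR0 (mul_nonneg (hk m) (hb _))) hterm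
      (hsum.mul_right S)) (hsum.mul_right S)

/- The truncation of the weight `exp (δ ‖n‖)` at height `R` makes the supremum `S` of the weighted
family finite. For `‖n‖ > 2 Z` the hypothesis gives the bound `S / 2`, which can be absorbed. -/
theorem min_exp_mul_le_of_norm_mul_le_conv {b k : G → ℝ} {δ M R : ℝ} (hδ : 0 ≤ δ) (hR : 1 ≤ R)
    (hb : ∀ n, 0 ≤ b n) (hM : ∀ n, b n ≤ M) (hk : ∀ n, 0 ≤ k n)
    (hsum : Summable fun m => Real.exp (δ * ‖m‖) * k m)
    (h : ∀ n, ‖n‖ * b n ≤ ∑' m, k m * b (n - m)) (n : G) :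
    min (Real.exp (δ * ‖n‖)) R * b n ≤
      Real.exp (δ * (2 * ∑' m, Real.exp (δ * ‖m‖) * k m)) * M := by
  set Z := ∑' m, Real.exp (δ * ‖m‖) * k m
  have hZ : 0 ≤ Z := tsum_nonneg fun m => mul_nonneg (Real.exp_pos _).le (hk m)
  set w : G → ℝ := fun n => min (Real.exp (δ * ‖n‖)) R
  have hw (n) : 0 ≤ w n := le_min (Real.exp_pos _).le (by linarith)
  have hbdd : BddAbove (Set.range fun n => w n * b n) := ⟨R * M, by
    rintro _ ⟨n, rfl⟩
    exact mul_le_mul (min_le_right _ _) (hM n) (hb n) (by linarith)⟩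
  set S := ⨆ n, w n * b n
  have hle (n) : w n * b n ≤ S := le_ciSup hbdd n
  have hS : 0 ≤ S := (mul_nonneg (hw 0) (hb 0)).trans (hle 0)
  have hmax (n) : w n * b n ≤ max (S / 2) (Real.exp (δ * (2 * Z)) * M) := by
    rcases le_or_gt ‖n‖ (2 * Z) with hn | hn
    · refine le_max_of_le_right (mul_le_mul ?_ (hM n) (hb n) (Real.exp_pos _).le)
      exact (min_le_left _ _).trans (Real.exp_le_exp.mpr (by gcongr))
    · refine le_max_of_le_left ?_
      have hconv : ‖n‖ * (w n * b n) ≤ Z * S :=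
        calc ‖n‖ * (w n * b n) = w n * (‖n‖ * b n) := by ring
          _ ≤ w n * ∑' m, k m * b (n - m) := mul_le_mul_of_nonneg_left (h n) (hw n)
          _ ≤ Z * S := min_exp_mul_tsum_le hδ hR hb hk hsum hle n
      exact le_of_mul_le_mul_left (hconv.trans (by nlinarith)) (lt_of_le_of_lt (by positivity) hn)
  have hM0 : 0 ≤ Real.exp (δ * (2 * Z)) * M :=
    mul_nonneg (Real.exp_pos _).le ((hb 0).trans (hM 0))
  rcases le_max_iff.mp (ciSup_le hmax : S ≤ _) with hhalf | hS'
  · exact (hle n).trans (by linarith)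
  · exact (hle n).trans hS'

theorem exists_le_exp_of_norm_mul_le_conv {b k : G → ℝ} {δ M : ℝ} (hδ : 0 ≤ δ)
    (hb : ∀ n, 0 ≤ b n) (hM : ∀ n, b n ≤ M) (hk : ∀ n, 0 ≤ k n)
    (hsum : Summable fun m => Real.exp (δ * ‖m‖) * k m)
    (h : ∀ n, ‖n‖ * b n ≤ ∑' m, k m * b (n - m)) :
    ∃ C, 0 ≤ C ∧ ∀ n, b n ≤ C * Real.exp (-(δ * ‖n‖)) := by
  refine ⟨Real.exp (δ * (2 * ∑' m, Real.exp (δ * ‖m‖) * k m)) * M,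
    mul_nonneg (Real.exp_pos _).le ((hb 0).trans (hM 0)), fun n => ?_⟩
  have hweight := min_exp_mul_le_of_norm_mul_le_conv (R := Real.exp (δ * ‖n‖)) hδ
    (Real.one_le_exp (by positivity)) hb hM hk hsum h n
  rwa [min_self, mul_comm, ← le_div_iff₀ (Real.exp_pos _), div_eq_mul_inv, ← Real.exp_neg]
    at hweight

end Convolution

end Decay

/-! ### Real-analytic functions -/

section Analytic

section Series

variable {α 𝕜 E F : Type*} [NontriviallyNormedField 𝕜] [NormedAddCommGroup E] [NormedSpace 𝕜 E]
  [NormedAddCommGroup F] [NormedSpace 𝕜 F] [CompleteSpace F]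

theorem hasFPowerSeriesOnBall_tsum {f : α → E → F} {p : α → FormalMultilinearSeries 𝕜 E F} {x : E}
    {r : NNReal} (hr : 0 < r) (hf : ∀ i, HasFPowerSeriesOnBall (f i) (p i) x r) {u : α → ℝ}
    (hu : Summable u) (hp : ∀ i q, ‖p i q‖ * r ^ q ≤ u i) :
    HasFPowerSeriesOnBall (fun y => ∑' i, f i y) (fun q => ∑' i, p i q) x r := by
  have hps (q : ℕ) : Summable fun i => ‖p i q‖ := by
    refine Summable.of_nonneg_of_le (fun _ => norm_nonneg _) (fun i => ?_)
      (hu.mul_right ((r : ℝ) ^ q)⁻¹)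
    rw [← div_eq_mul_inv, le_div_iff₀ (by positivity)]
    exact hp i q
  refine ⟨FormalMultilinearSeries.le_radius_of_bound _ (∑' i, u i) fun q => ?_,
    by exact_mod_cast hr, fun {y} hy => ?_⟩
  · calc ‖∑' i, p i q‖ * (r : ℝ) ^ q ≤ (∑' i, ‖p i q‖) * r ^ q := by
          gcongr; exact norm_tsum_le_tsum_norm (hps q)
      _ = ∑' i, ‖p i q‖ * r ^ q := tsum_mul_right.symm
      _ ≤ ∑' i, u i := Summable.tsum_le_tsum (fun i => hp i q) ((hps q).mul_right _) hu
  · have hyr : ‖y‖ / r < 1 := by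
      rw [Metric.mem_eball, edist_zero_right] at hy
      exact (div_lt_one (by positivity)).mpr (by exact_mod_cast (enorm_lt_coe.mp hy))
    have hsum : Summable fun z : α × ℕ => p z.1 z.2 fun _ => y := by
      refine Summable.of_norm_bounded (hu.mul_of_nonneg
        (summable_geometric_of_lt_one (by positivity) hyr)
        (fun i => (by positivity : (0 : ℝ) ≤ _).trans (hp i 0)) fun q => by positivity) fun z => ?_
      calc ‖p z.1 z.2 fun _ => y‖ ≤ ‖p z.1 z.2‖ * ‖y‖ ^ z.2 := by
            simpa using (p z.1 z.2).le_opNorm fun _ => y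
        _ = ‖p z.1 z.2‖ * r ^ z.2 * (‖y‖ / r) ^ z.2 := by
            rw [div_pow]; field_simp
        _ ≤ u z.1 * (‖y‖ / r) ^ z.2 := by gcongr; exact hp _ _
    have htsum : ∑' z : α × ℕ, (p z.1 z.2 fun _ => y) = ∑' i, f i (x + y) := by
      rw [hsum.tsum_prod' fun i => ((hf i).hasSum hy).summable]
      exact tsum_congr fun i => ((hf i).hasSum hy).tsum_eq
    have hswap : HasSum (fun z : ℕ × α => p z.2 z.1 fun _ => y) (∑' i, f i (x + y)) := by
      rw [← htsum]
      exact (Equiv.prodComm ℕ α).hasSum_iff.mpr hsum.hasSum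
    exact hswap.prod_fiberwise fun q => (hps q).of_norm.hasSum.mapL
      (ContinuousMultilinearMap.apply 𝕜 (fun _ : Fin q => E) F fun _ => y)

end Series

section Exponential

variable {E : Type*} [NormedAddCommGroup E] [NormedSpace ℝ E]

/-- The Taylor series of `c exp ∘ ℓ` at `x`, where `ℓ` is a continuous linear functional. -/
def expLinearSeries (c : ℂ) (ℓ : E →L[ℝ] ℂ) (x : E) : FormalMultilinearSeries ℝ E ℂ := fun q =>
  (c * Complex.exp (ℓ x) / (q.factorial : ℂ)) •
    (ContinuousMultilinearMap.mkPiAlgebraFin ℝ q ℂ).compContinuousLinearMap fun _ => ℓ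

theorem norm_expLinearSeries_le (c : ℂ) (ℓ : E →L[ℝ] ℂ) (x : E) (q : ℕ) :
    ‖expLinearSeries c ℓ x q‖ ≤ ‖c * Complex.exp (ℓ x)‖ * (‖ℓ‖ ^ q / q.factorial) := by
  rw [expLinearSeries, norm_smul, norm_div, Complex.norm_natCast, mul_div_assoc',
    div_mul_eq_mul_div]
  gcongr
  exact (ContinuousMultilinearMap.norm_compContinuousLinearMap_le _ _).trans (by simp)

theorem hasFPowerSeriesOnBall_expLinearSeries (c : ℂ) (ℓ : E →L[ℝ] ℂ) (x : E) :
    HasFPowerSeriesOnBall (fun y => c * Complex.exp (ℓ y)) (expLinearSeries c ℓ x) x ⊤ := by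
  refine ⟨?_, ENNReal.zero_lt_top, fun {y} _ => ?_⟩
  · refine (ENNReal.eq_top_of_forall_nnreal_le fun r =>
      FormalMultilinearSeries.le_radius_of_bound _
        (‖c * Complex.exp (ℓ x)‖ * Real.exp (‖ℓ‖ * r)) fun q => ?_).ge
    calc ‖expLinearSeries c ℓ x q‖ * (r : ℝ) ^ q
        ≤ ‖c * Complex.exp (ℓ x)‖ * (‖ℓ‖ ^ q / q.factorial) * r ^ q := by
          gcongr; exact norm_expLinearSeries_le c ℓ x q
      _ = ‖c * Complex.exp (ℓ x)‖ * ((‖ℓ‖ * r) ^ q / q.factorial) := by rw [mul_pow]; ring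
      _ ≤ ‖c * Complex.exp (ℓ x)‖ * Real.exp (‖ℓ‖ * r) := by
          gcongr; exact Real.pow_div_factorial_le_exp _ (by positivity) q
  · have hexp := (NormedSpace.exp_series_hasSum_exp' (𝕂 := ℂ) (ℓ y)).mul_left
      (c * Complex.exp (ℓ x))
    rw [← Complex.exp_eq_exp_ℂ, mul_assoc, ← Complex.exp_add, ← map_add] at hexp
    refine hexp.congr_fun fun q => ?_
    simp only [expLinearSeries, smul_apply,
      ContinuousMultilinearMap.compContinuousLinearMap_apply,
      ContinuousMultilinearMap.mkPiAlgebraFin_apply, List.ofFn_const, List.prod_replicate,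
      smul_eq_mul]
    ring

theorem norm_expLinearSeries_mul_pow_le {c : ℂ} {ℓ : E →L[ℝ] ℂ} (hre : ∀ x, (ℓ x).re = 0)
    {r : ℝ} (hr : 0 ≤ r) (x : E) (q : ℕ) :
    ‖expLinearSeries c ℓ x q‖ * r ^ q ≤ ‖c‖ * Real.exp (‖ℓ‖ * r) :=
  calc ‖expLinearSeries c ℓ x q‖ * r ^ q
      ≤ ‖c * Complex.exp (ℓ x)‖ * (‖ℓ‖ ^ q / q.factorial) * r ^ q := by
        gcongr; exact norm_expLinearSeries_le c ℓ x q
    _ = ‖c‖ * ((‖ℓ‖ * r) ^ q / q.factorial) := by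
        rw [norm_mul, Complex.norm_exp, hre, Real.exp_zero, mul_pow]; ring
    _ ≤ ‖c‖ * Real.exp (‖ℓ‖ * r) := by
        gcongr; exact Real.pow_div_factorial_le_exp _ (by positivity) q

theorem analyticOnNhd_tsum_exp {ι : Type*} [Fintype ι] {a : (ι → ℤ) → ℂ} (ha : ExpDecay a)
    {ℓ : (ι → ℤ) → E →L[ℝ] ℂ} {M : ℝ} (hM : 0 ≤ M) (hℓ : ∀ n, ‖ℓ n‖ ≤ M * ‖n‖)
    (hre : ∀ n x, (ℓ n x).re = 0) :
    AnalyticOnNhd ℝ (fun x => ∑' n, a n * Complex.exp (ℓ n x)) univ := by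
  intro x _
  obtain ⟨C, ε, hC, hε, H⟩ := ha
  have hr : 0 < ε / (2 * (M + 1)) := by positivity
  lift ε / (2 * (M + 1)) to NNReal using hr.le with r hr_eq
  have hMr : M * r ≤ ε / 2 := by
    rw [hr_eq, mul_div_assoc', div_le_div_iff₀ (by positivity) (by positivity)]
    nlinarith
  have hbound (n : ι → ℤ) (q : ℕ) : ‖expLinearSeries (a n) (ℓ n) x q‖ * (r : ℝ) ^ q ≤
      C * Real.exp (-(ε / 2 * ‖n‖)) :=
    calc ‖expLinearSeries (a n) (ℓ n) x q‖ * (r : ℝ) ^ q ≤ ‖a n‖ * Real.exp (‖ℓ n‖ * r) :=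
          norm_expLinearSeries_mul_pow_le (hre n) r.2 x q
      _ ≤ C * Real.exp (-(ε * ‖n‖)) * Real.exp (ε / 2 * ‖n‖) := by
          refine mul_le_mul (H n) (Real.exp_le_exp.mpr ?_) (Real.exp_pos _).le (by positivity)
          calc ‖ℓ n‖ * r ≤ M * ‖n‖ * r := by gcongr; exact hℓ n
            _ = M * r * ‖n‖ := by ring
            _ ≤ ε / 2 * ‖n‖ := by gcongr
      _ = C * Real.exp (-(ε / 2 * ‖n‖)) := by
          rw [mul_assoc, ← Real.exp_add]; congr 2; ring
  exact (hasFPowerSeriesOnBall_tsum (by exact_mod_cast hr)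
    (fun n => (hasFPowerSeriesOnBall_expLinearSeries (a n) (ℓ n) x).mono
      (by exact_mod_cast hr) le_top)
    ((summable_exp_neg_mul_norm (half_pos hε)).mul_left C) hbound).analyticAt

end Exponential

section ChangeOrigin

variable {𝕜 E F : Type*} [NontriviallyNormedField 𝕜] [NormedAddCommGroup E] [NormedSpace 𝕜 E]
  [NormedAddCommGroup F] [NormedSpace 𝕜 F]

theorem exists_norm_changeOrigin_mul_pow_le (p : FormalMultilinearSeries 𝕜 E F) {r : NNReal}
    (hr : (r + r : ENNReal) < p.radius) :
    ∃ S : NNReal, ∀ y : E, ‖y‖₊ ≤ r → ∀ q, ‖p.changeOrigin y q‖ * (r : ℝ) ^ q ≤ S := by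
  have hsum := p.changeOriginSeries_summable_aux₁ hr
  have hr' : (r : ENNReal) < p.radius := lt_of_le_of_lt le_self_add hr
  refine ⟨∑' s : Σ k l : ℕ, {s : Finset (Fin (k + l)) // s.card = l},
    ‖p (s.1 + s.2.1)‖₊ * r ^ s.2.1 * r ^ s.1, fun y hy q => ?_⟩
  have hyr : (‖y‖₊ : ENNReal) < p.radius := lt_of_le_of_lt (by exact_mod_cast hy) hr'
  have key : ‖p.changeOrigin y q‖₊ * r ^ q ≤
      ∑' s : Σ k l : ℕ, {s : Finset (Fin (k + l)) // s.card = l},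
        ‖p (s.1 + s.2.1)‖₊ * r ^ s.2.1 * r ^ s.1 :=
    calc ‖p.changeOrigin y q‖₊ * r ^ q
        ≤ (∑' s : Σ l : ℕ, {s : Finset (Fin (q + l)) // s.card = l},
            ‖p (q + s.1)‖₊ * r ^ s.1) * r ^ q := by
          gcongr
          exact (p.nnnorm_changeOrigin_le q hyr).trans
            (Summable.tsum_le_tsum (fun s => by gcongr)
              (p.changeOriginSeries_summable_aux₂ hyr q)
              (p.changeOriginSeries_summable_aux₂ hr' q))
      _ = ∑' s : Σ l : ℕ, {s : Finset (Fin (q + l)) // s.card = l},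
            ‖p (q + s.1)‖₊ * r ^ s.1 * r ^ q := (NNReal.tsum_mul_right _ _).symm
      _ ≤ _ := by
          have hfib := NNReal.summable_sigma.1 hsum
          have htotal := hfib.2.hasSum
          rw [← hsum.tsum_sigma' hfib.1] at htotal
          exact le_hasSum htotal q fun _ _ => zero_le
  exact_mod_cast key

end ChangeOrigin

section CauchyEstimate

variable {E F : Type*} [NormedAddCommGroup E] [NormedSpace ℝ E] [NormedAddCommGroup F]
  [NormedSpace ℝ F] [CompleteSpace F] {f : E → F}

theorem eventually_norm_iteratedFDeriv_le {x₀ : E} (hf : AnalyticAt ℝ f x₀) :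
    ∃ C r : ℝ, 0 ≤ C ∧ 0 < r ∧ ∀ᶠ x in 𝓝 x₀, ∀ (q : ℕ) (w : E),
      ‖iteratedFDeriv ℝ q f x fun _ => w‖ ≤ C * q.factorial * (‖w‖ / r) ^ q := by
  obtain ⟨p, R, hp⟩ := hf
  obtain ⟨ρ, hρ, hρR⟩ := ENNReal.lt_iff_exists_nnreal_btwn.mp hp.r_pos
  have hadd : ((ρ / 2 : NNReal) + (ρ / 2 : NNReal) : ENNReal) = ρ := by
    exact_mod_cast add_halves ρ
  have hr : 0 < ρ / 2 := half_pos (by exact_mod_cast hρ)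
  obtain ⟨S, hS⟩ := exists_norm_changeOrigin_mul_pow_le p (hadd ▸ hρR.trans_le hp.r_le)
  refine ⟨S, (ρ / 2 : NNReal), S.2, hr, ?_⟩
  filter_upwards [Metric.ball_mem_nhds x₀ hr] with x hx q w
  have hy : ‖x - x₀‖₊ < ρ / 2 := by exact_mod_cast mem_ball_iff_norm.mp hx
  have hyR : (‖x - x₀‖₊ : ENNReal) < R :=
    (lt_of_lt_of_le (by exact_mod_cast hy) le_self_add).trans_le (hadd ▸ hρR.le)
  have htaylor := (hp.changeOrigin hyR).factorial_smul w q
  rw [add_sub_cancel] at htaylor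
  rw [← htaylor, ← Nat.cast_smul_eq_nsmul ℝ, norm_smul, RCLike.norm_natCast]
  calc q.factorial * ‖p.changeOrigin (x - x₀) q fun _ => w‖
      ≤ q.factorial * (S / (ρ / 2 : NNReal) ^ q * ‖w‖ ^ q) := by
        gcongr
        refine ((p.changeOrigin (x - x₀) q).le_opNorm fun _ => w).trans ?_
        rw [Finset.prod_const, Finset.card_univ, Fintype.card_fin]
        gcongr
        exact (le_div_iff₀ (by positivity)).mpr (hS _ hy.le q)
    _ = S * q.factorial * (‖w‖ / (ρ / 2 : NNReal)) ^ q := by rw [div_pow]; ring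

theorem exists_norm_iteratedFDeriv_le {K : Set E} (hK : IsCompact K) (hf : AnalyticOnNhd ℝ f K) :
    ∃ C r : ℝ, 0 ≤ C ∧ 0 < r ∧ ∀ x ∈ K, ∀ (q : ℕ) (w : E),
      ‖iteratedFDeriv ℝ q f x fun _ => w‖ ≤ C * q.factorial * (‖w‖ / r) ^ q := by
  refine hK.induction_on (p := fun K => ∃ C r : ℝ, 0 ≤ C ∧ 0 < r ∧ ∀ x ∈ K, ∀ (q : ℕ) (w : E),
      ‖iteratedFDeriv ℝ q f x fun _ => w‖ ≤ C * q.factorial * (‖w‖ / r) ^ q)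
    ⟨0, 1, le_rfl, one_pos, fun x hx => hx.elim⟩ ?_ ?_ ?_
  · rintro s t hst ⟨C, r, hC, hr, h⟩
    exact ⟨C, r, hC, hr, fun x hx => h x (hst hx)⟩
  · rintro s t ⟨C, r, hC, hr, h⟩ ⟨C', r', _, hr', h'⟩
    refine ⟨max C C', min r r', le_max_of_le_left hC, lt_min hr hr', fun x hx q w => ?_⟩
    rcases hx with hx | hx
    · refine (h x hx q w).trans ?_
      gcongr
      exacts [le_max_left _ _, min_le_left _ _]
    · refine (h' x hx q w).trans ?_
      gcongr
      exacts [le_max_right _ _, min_le_right _ _]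
  · intro x₀ hx₀
    obtain ⟨C, r, hC, hr, h⟩ := eventually_norm_iteratedFDeriv_le (hf x₀ hx₀)
    exact ⟨_, mem_nhdsWithin_of_mem_nhds h, C, r, hC, hr, fun x hx => hx⟩

end CauchyEstimate

end Analytic

/-! ### The Brillouin torus as a standard torus -/

section Transfer

variable {d : ℕ} (γ : Module.Basis (Fin d) ℝ (Space d))

theorem injective_inner_div_two_pi :
    Function.Injective fun (k : Space d) j => ⟪k, γ j⟫_ℝ / (2 * Real.pi) := fun k k' h =>
  InnerProductSpace.ext_inner_right_basis γ fun j => by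
    simpa [div_left_inj' Real.two_pi_pos.ne'] using congrFun h j

/-- The coordinates `k ↦ (k · γ_j / 2π)_j` of a momentum with respect to the dual basis of `γ`. -/
def coords : Space d ≃L[ℝ] (Fin d → ℝ) :=
  (LinearMap.linearEquivOfInjective
    { toFun := fun k j => ⟪k, γ j⟫_ℝ / (2 * Real.pi)
      map_add' := fun x y => by ext j; simp [inner_add_left, add_div]
      map_smul' := fun c x => by ext j; simp [inner_smul_left, mul_div_assoc] }
    (injective_inner_div_two_pi γ) (by simp)).toContinuousLinearEquiv

theorem coords_apply (k : Space d) (j : Fin d) : coords γ k j = ⟪k, γ j⟫_ℝ / (2 * Real.pi) := rfl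

theorem inner_eq_coords (k : Space d) (j : Fin d) : ⟪k, γ j⟫_ℝ = 2 * Real.pi * coords γ k j := by
  rw [coords_apply]; field_simp

theorem dualCell_eq : dualCell γ = coords γ ⁻¹' Set.Icc (fun _ => -(1 / 2)) (fun _ => 1 / 2) := by
  ext k
  simp only [dualCell, mem_ofPred_eq, mem_preimage, mem_Icc, Pi.le_def, coords_apply]
  exact forall_and

theorem isCompact_dualCell : IsCompact (dualCell γ) := by
  rw [dualCell_eq]
  exact (coords γ).toHomeomorph.isCompact_preimage.mpr isCompact_Icc

theorem mem_dualLattice_iff {k : Space d} :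
    k ∈ dualLattice γ ↔ ∃ n : Fin d → ℤ, coords γ k = fun j => (n j : ℝ) := by
  constructor
  · intro hk
    choose n hn using fun j => hk (γ j) (AddSubgroup.subset_closure (mem_range_self j))
    exact ⟨n, funext fun j => by rw [coords_apply, hn]; field_simp⟩
  · rintro ⟨n, hn⟩ g hg
    induction hg using AddSubgroup.closure_induction with
    | mem x hx => obtain ⟨j, rfl⟩ := hx; exact ⟨n j, by rw [inner_eq_coords, hn]⟩
    | zero => exact ⟨0, by simp⟩
    | add x y _ _ hx hy =>
      obtain ⟨a, ha⟩ := hx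
      obtain ⟨b, hb⟩ := hy
      exact ⟨a + b, by rw [inner_add_right, ha, hb]; push_cast; ring⟩
    | neg x _ hx =>
      obtain ⟨a, ha⟩ := hx
      exact ⟨-a, by rw [inner_neg_right, ha]; push_cast; ring⟩

/-- The covering map of the standard torus by momentum space; its fibres are the cosets of
`dualLattice γ`. -/
def toTorus (k : Space d) : UnitAddTorus (Fin d) := fun j => (coords γ k j : UnitAddCircle)

theorem toTorus_add (k v : Space d) : toTorus γ (k + v) = toTorus γ k + toTorus γ v := by
  ext j
  simp [toTorus]

theorem sub_mem_dualLattice {k k' : Space d} (h : toTorus γ k = toTorus γ k') :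
    k - k' ∈ dualLattice γ := by
  have hint (j : Fin d) : ∃ n : ℤ, n • (1 : ℝ) = coords γ k j - coords γ k' j := by
    rw [← AddCircle.coe_eq_zero_iff, AddCircle.coe_sub, sub_eq_zero]
    exact congrFun h j
  choose n hn using hint
  refine (mem_dualLattice_iff γ).mpr ⟨n, funext fun j => ?_⟩
  simpa using (hn j).symm

/-- The section of `toTorus` with values in the centered cell. -/
def cellSection (t : UnitAddTorus (Fin d)) : Space d :=
  (coords γ).symm (measurableEquivPiIoc (fun _ => -(1 / 2)) t).1

theorem coords_cellSection (t : UnitAddTorus (Fin d)) (j : Fin d) :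
    coords γ (cellSection γ t) j = (AddCircle.equivIoc 1 (-(1 / 2) : ℝ) (t j)).1 := by
  simp [cellSection]

theorem toTorus_cellSection (t : UnitAddTorus (Fin d)) : toTorus γ (cellSection γ t) = t := by
  ext j
  rw [toTorus, coords_cellSection]
  exact AddCircle.coe_equivIoc

theorem cellSection_mem_dualCell (t : UnitAddTorus (Fin d)) : cellSection γ t ∈ dualCell γ := by
  intro j
  rw [← coords_apply, coords_cellSection]
  have hmem := (AddCircle.equivIoc 1 (-(1 / 2) : ℝ) (t j)).2
  exact ⟨hmem.1.le, hmem.2.trans (by norm_num)⟩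

theorem measurableEmbedding_cellSection : MeasurableEmbedding (cellSection γ) := by
  refine (coords γ).symm.toHomeomorph.measurableEmbedding.comp
    ((MeasurableEmbedding.subtype_coe ?_).comp (measurableEquivPiIoc _).measurableEmbedding)
  exact MeasurableSet.univ_pi' fun _ => measurableSet_Ioc

theorem coords_symm_preimage_dualCell_ae_eq : (coords γ).symm ⁻¹' dualCell γ =ᵐ[volume]
    {x : Fin d → ℝ | ∀ i, x i ∈ Ioc (-(1 / 2) : ℝ) (-(1 / 2) + 1)} := by
  have hcell : (coords γ).symm ⁻¹' dualCell γ =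
      (Set.Icc (fun _ => -(1 / 2)) (fun _ => 1 / 2) : Set (Fin d → ℝ)) := by
    rw [dualCell_eq, ← Set.preimage_comp]
    simp
  have hpi : {x : Fin d → ℝ | ∀ i, x i ∈ Ioc (-(1 / 2) : ℝ) (-(1 / 2) + 1)} =
      Set.univ.pi fun _ => Set.Ioc (-(1 / 2) : ℝ) (1 / 2) := by
    ext x
    simp only [mem_ofPred_eq, Set.mem_univ_pi]
    norm_num
  rw [hcell, hpi, volume_pi]
  exact (Measure.univ_pi_Ioc_ae_eq_Icc (μ := fun _ : Fin d => (volume : Measure ℝ))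
    (f := fun _ => -(1 / 2)) (g := fun _ => 1 / 2)).symm

theorem exists_measurePreserving_cellSection : ∃ c : NNReal, c ≠ 0 ∧
    MeasurePreserving (cellSection γ) volume (c • volume.restrict (dualCell γ)) := by
  set μ : Measure (Space d) := Measure.map (coords γ).symm volume
  have hHaar : μ.IsAddHaarMeasure := ContinuousLinearEquiv.isAddHaarMeasure_map _ _
  refine ⟨Measure.addHaarScalarFactor μ volume,
    (Measure.addHaarScalarFactor_pos_of_isAddHaarMeasure μ volume).ne', ?_⟩
  have hμ : μ = Measure.addHaarScalarFactor μ volume • (volume : Measure (Space d)) :=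
    Measure.isAddLeftInvariant_eq_smul μ volume
  have hcoords : MeasurePreserving (coords γ).symm (volume : Measure (Fin d → ℝ)) μ :=
    ⟨(coords γ).symm.continuous.measurable, rfl⟩
  have hcell := hcoords.restrict_preimage (isCompact_dualCell γ).measurableSet
  rw [Measure.restrict_congr_set (coords_symm_preimage_dualCell_ae_eq γ)] at hcell
  rw [← Measure.restrict_smul, ← hμ]
  exact hcell.comp ((measurePreserving_subtype_coe
    (MeasurableSet.univ_pi' fun i => measurableSet_Ioc)).comp
      (measurePreserving_equivPiIoc (d := Fin d) fun _ => (-(1 / 2) : ℝ)))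

theorem memLp_comp_cellSection {F : Type*} [NormedAddCommGroup F] {f : Space d → F} {p : ENNReal}
    (hf : MemLp f p (volume.restrict (dualCell γ))) :
    MemLp (fun t => f (cellSection γ t)) p volume := by
  obtain ⟨c, -, hc⟩ := exists_measurePreserving_cellSection γ
  exact (hf.smul_measure (c := (c : ENNReal)) ENNReal.coe_ne_top).comp_measurePreserving hc

theorem exists_integral_cellSection : ∃ c : ℝ, ∀ f : Space d → ℂ,
    ∫ t, f (cellSection γ t) = c * ∫ k in dualCell γ, f k := by
  obtain ⟨c, -, hc⟩ := exists_measurePreserving_cellSection γ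
  refine ⟨c, fun f => ?_⟩
  rw [hc.integral_comp (measurableEmbedding_cellSection γ), integral_smul_nnreal_measure]
  exact Complex.real_smul

theorem ae_cellSection_iff {p : Space d → Prop} :
    (∀ᵐ t, p (cellSection γ t)) ↔ ∀ᵐ k ∂volume.restrict (dualCell γ), p k := by
  obtain ⟨c, hc0, hc⟩ := exists_measurePreserving_cellSection γ
  rw [← (measurableEmbedding_cellSection γ).ae_map_iff, hc.map_eq]
  exact Measure.ae_ennreal_smul_measure_iff (c := (c : ENNReal)) (by exact_mod_cast hc0)

theorem aestronglyMeasurable_comp_cellSection {F : Type*} [NormedAddCommGroup F] {f : Space d → F}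
    (hc : Continuous f) : AEStronglyMeasurable (fun t => f (cellSection γ t)) volume :=
  hc.aestronglyMeasurable.comp_measurable (measurableEmbedding_cellSection γ).measurable

theorem exists_add_mem_dualCell (k : Space d) :
    ∃ n : Fin d → ℤ, k + (coords γ).symm (fun j => (n j : ℝ)) ∈ dualCell γ := by
  obtain ⟨n, hn⟩ := (mem_dualLattice_iff γ).mp
    (sub_mem_dualLattice γ (toTorus_cellSection γ (toTorus γ k)))
  refine ⟨n, ?_⟩
  rw [← hn, ContinuousLinearEquiv.symm_apply_apply, add_sub_cancel]
  exact cellSection_mem_dualCell γ _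

variable {γ}

theorem IsPeriodic.comp {E F : Type*} {f : Space d → E} (hf : IsPeriodic γ f) (g : E → F) :
    IsPeriodic γ fun k => g (f k) :=
  fun k l hl => congrArg g (hf k l hl)

theorem IsPeriodic.apply_eq {F : Type*} {f : Space d → F} (hf : IsPeriodic γ f) {k k' : Space d}
    (h : toTorus γ k = toTorus γ k') : f k = f k' := by
  simpa using hf k' _ (sub_mem_dualLattice γ h)

theorem IsPeriodic.apply_cellSection_add {F : Type*} {f : Space d → F} (hf : IsPeriodic γ f)
    (t : UnitAddTorus (Fin d)) (v : Space d) :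
    f (cellSection γ t + v) = f (cellSection γ (t + toTorus γ v)) :=
  hf.apply_eq (by rw [toTorus_add, toTorus_cellSection, toTorus_cellSection])

theorem IsPeriodic.apply_cellSection_toTorus {F : Type*} {f : Space d → F} (hf : IsPeriodic γ f)
    (k : Space d) : f (cellSection γ (toTorus γ k)) = f k :=
  hf.apply_eq (toTorus_cellSection γ _)

theorem IsPeriodic.exists_norm_le {F : Type*} [NormedAddCommGroup F] {f : Space d → F}
    (hf : IsPeriodic γ f) (hc : Continuous f) : ∃ C, ∀ k, ‖f k‖ ≤ C := by
  obtain ⟨C, hC⟩ := (isCompact_dualCell γ).exists_bound_of_continuousOn hc.continuousOn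
  exact ⟨C, fun k => hf.apply_cellSection_toTorus k ▸ hC _ (cellSection_mem_dualCell γ _)⟩

theorem IsPeriodic.memLp_top {F : Type*} [NormedAddCommGroup F] {f : Space d → F}
    (hf : IsPeriodic γ f) (hc : Continuous f) :
    MemLp (fun t => f (cellSection γ t)) ⊤ volume := by
  obtain ⟨C, hC⟩ := hf.exists_norm_le hc
  exact memLp_top_of_bound (aestronglyMeasurable_comp_cellSection γ hc) C
    (Eventually.of_forall fun t => hC _)

theorem IsPeriodic.ae_eq_of_ae_eq_cellSection {F : Type*} {f g : Space d → F}
    (hf : IsPeriodic γ f) (hg : IsPeriodic γ g)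
    (h : ∀ᵐ t, f (cellSection γ t) = g (cellSection γ t)) : f =ᵐ[volume] g := by
  rw [ae_cellSection_iff γ (p := fun k => f k = g k),
    ae_restrict_iff' (isCompact_dualCell γ).measurableSet] at h
  have htranslates : ∀ᵐ k : Space d, ∀ n : Fin d → ℤ,
      k + (coords γ).symm (fun j => (n j : ℝ)) ∈ dualCell γ →
        f (k + (coords γ).symm fun j => (n j : ℝ)) = g (k + (coords γ).symm fun j => (n j : ℝ)) :=
    ae_all_iff.mpr fun n => (measurePreserving_add_right volume
      ((coords γ).symm fun j => (n j : ℝ))).quasiMeasurePreserving.ae h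
  filter_upwards [htranslates] with k hk
  obtain ⟨n, hn⟩ := exists_add_mem_dualCell γ k
  have hmem : (coords γ).symm (fun j => (n j : ℝ)) ∈ dualLattice γ :=
    (mem_dualLattice_iff γ).mpr ⟨n, by simp⟩
  rw [← hf k _ hmem, ← hg k _ hmem]
  exact hk n hn

end Transfer

/-! ### Fourier series of periodic functions -/

section PeriodicFourier

variable {d : ℕ} (γ : Module.Basis (Fin d) ℝ (Space d))

/-- The lattice vector `∑ n_j γ_j`, which is the frequency of the `n`-th character of the
Brillouin torus. -/
def freq (n : Fin d → ℤ) : Space d := ∑ j, (n j : ℝ) • γ j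

theorem freq_add (m n : Fin d → ℤ) : freq γ (m + n) = freq γ m + freq γ n := by
  simp only [freq, Pi.add_apply, Int.cast_add, add_smul, Finset.sum_add_distrib]

theorem freq_mem_lattice (n : Fin d → ℤ) : freq γ n ∈ lattice γ := by
  refine AddSubgroup.sum_mem _ fun j _ => ?_
  rw [Int.cast_smul_eq_zsmul]
  exact AddSubgroup.zsmul_mem _ (AddSubgroup.subset_closure (mem_range_self j)) _

theorem exists_norm_freq_le : ∃ M : ℝ, 0 ≤ M ∧ ∀ n, ‖freq γ n‖ ≤ M * ‖n‖ := by
  refine ⟨∑ j, ‖γ j‖, Finset.sum_nonneg fun _ _ => norm_nonneg _, fun n => ?_⟩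
  rw [freq, Finset.sum_mul]
  refine norm_sum_le_of_le _ fun j _ => ?_
  rw [norm_smul, mul_comm]
  gcongr
  simpa [Int.norm_eq_abs] using norm_le_pi_norm n j

theorem exists_norm_le_freq : ∃ K : ℝ, 0 < K ∧ ∀ n, ‖n‖ ≤ K * ‖freq γ n‖ := by
  set L : Space d →L[ℝ] (Fin d → ℝ) := γ.equivFunL.toContinuousLinearMap
  have hL (n : Fin d → ℤ) (j : Fin d) : L (freq γ n) j = n j := by
    change γ.equivFun (freq γ n) j = n j
    simp [freq, Finsupp.single_apply]
  refine ⟨‖L‖ + 1, by positivity, fun n => (pi_norm_le_iff_of_nonneg (by positivity)).mpr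
    fun j => ?_⟩
  calc ‖n j‖ = ‖L (freq γ n) j‖ := by rw [hL, Int.norm_eq_abs, Real.norm_eq_abs]
    _ ≤ ‖L‖ * ‖freq γ n‖ := (norm_le_pi_norm _ j).trans (L.le_opNorm _)
    _ ≤ (‖L‖ + 1) * ‖freq γ n‖ := by gcongr; linarith

/-- The Fourier multiplier of the derivative in direction `w`. -/
def symbol (w : Space d) : (Fin d → ℤ) →+ ℂ where
  toFun n := Complex.I * (⟪freq γ n, w⟫_ℝ : ℝ)
  map_zero' := by simp [freq]
  map_add' m n := by rw [freq_add, inner_add_left]; push_cast; ring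

theorem symbol_apply (w : Space d) (n : Fin d → ℤ) :
    symbol γ w n = Complex.I * (⟪freq γ n, w⟫_ℝ : ℝ) := rfl

theorem conj_symbol (w : Space d) (n : Fin d → ℤ) : conj (symbol γ w n) = -symbol γ w n := by
  simp [symbol_apply]

theorem norm_symbol (w : Space d) (n : Fin d → ℤ) : ‖symbol γ w n‖ = |⟪freq γ n, w⟫_ℝ| := by
  rw [symbol_apply, norm_mul, Complex.norm_I, one_mul, Complex.norm_real, Real.norm_eq_abs]

theorem exists_norm_le_sum_norm_symbol : ∃ K : ℝ, 0 < K ∧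
    ∀ n : Fin d → ℤ, ‖n‖ ≤ K * ∑ j, ‖symbol γ (EuclideanSpace.single j 1) n‖ := by
  obtain ⟨K, hK, hle⟩ := exists_norm_le_freq γ
  refine ⟨K, hK, fun n => (hle n).trans ?_⟩
  gcongr
  conv_lhs => rw [← (EuclideanSpace.basisFun (Fin d) ℝ).sum_repr (freq γ n)]
  refine norm_sum_le_of_le _ fun j _ => ?_
  rw [norm_symbol, EuclideanSpace.inner_single_right]
  simp [norm_smul]

/-- The character `k ↦ e^{i (∑ n_j γ_j) · k}`. -/
def char (n : Fin d → ℤ) (k : Space d) : ℂ := Complex.exp (Complex.I * (⟪freq γ n, k⟫_ℝ : ℝ))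

theorem char_eq_mFourier (n : Fin d → ℤ) (k : Space d) : char γ n k = mFourier n (toTorus γ k) := by
  simp only [char, mFourier, ContinuousMap.coe_mk, toTorus, fourier_coe_apply, ← Complex.exp_sum]
  congr 1
  rw [freq, sum_inner, Complex.ofReal_sum, Finset.mul_sum]
  refine Finset.sum_congr rfl fun j _ => ?_
  rw [inner_smul_left, real_inner_comm, inner_eq_coords]
  push_cast
  simp only [RCLike.conj_to_real, Complex.ofReal_intCast]
  ring

theorem char_cellSection (n : Fin d → ℤ) (t : UnitAddTorus (Fin d)) :
    char γ n (cellSection γ t) = mFourier n t := by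
  rw [char_eq_mFourier, toTorus_cellSection]

theorem isPeriodic_char (n : Fin d → ℤ) : IsPeriodic γ (char γ n) := by
  intro k l hl
  obtain ⟨N, hN⟩ := hl _ (freq_mem_lattice γ n)
  rw [char, char, inner_add_right, real_inner_comm l, hN, Complex.exp_eq_exp_iff_exists_int]
  exact ⟨N, by push_cast; ring⟩

theorem contDiff_char (n : Fin d → ℤ) : ContDiff ℝ ∞ (char γ n) := by
  have hinner : ContDiff ℝ ∞ fun k : Space d => ((⟪freq γ n, k⟫_ℝ : ℝ) : ℂ) :=
    Complex.ofRealCLM.contDiff.comp (contDiff_const.inner ℝ contDiff_id)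
  exact (contDiff_const.mul hinner).cexp

theorem fderiv_char (n : Fin d → ℤ) (k w : Space d) :
    fderiv ℝ (char γ n) k w = symbol γ w n * char γ n k := by
  have hinner : HasFDerivAt (fun k : Space d => ((⟪freq γ n, k⟫_ℝ : ℝ) : ℂ))
      (Complex.ofRealCLM.comp (innerSL ℝ (freq γ n))) k :=
    (Complex.ofRealCLM.comp (innerSL ℝ (freq γ n))).hasFDerivAt
  have hchar : HasFDerivAt (char γ n) _ k := (hinner.const_mul Complex.I).cexp
  rw [hchar.fderiv, symbol_apply, char]
  simp only [smul_apply, smul_eq_mul, ContinuousLinearMap.comp_apply, Complex.ofRealCLM_apply,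
    innerSL_apply_apply]
  ring

theorem analyticOnNhd_tsum_char {a : (Fin d → ℤ) → ℂ} (ha : ExpDecay a) :
    AnalyticOnNhd ℝ (fun k => ∑' n, a n * char γ n k) univ := by
  obtain ⟨M, hM₀, hM⟩ := exists_norm_freq_le γ
  refine analyticOnNhd_tsum_exp ha
    (ℓ := fun n => (Complex.I • Complex.ofRealCLM).comp (innerSL ℝ (freq γ n))) hM₀ (fun n => ?_)
    fun n x => by simp
  refine ContinuousLinearMap.opNorm_le_bound _ (by positivity) fun x => ?_
  have hx : ‖⟪freq γ n, x⟫_ℝ‖ ≤ M * ‖n‖ * ‖x‖ :=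
    (norm_inner_le_norm _ _).trans (by gcongr; exact hM n)
  simpa using hx

theorem ae_eq_tsum_char {f : UnitAddTorus (Fin d) → ℂ} (hf : MemLp f 2 volume)
    (ha : ExpDecay fun n => mFourierCoeff f n) :
    ∀ᵐ t, f t = ∑' n, mFourierCoeff f n * char γ n (cellSection γ t) := by
  have hsum : Summable fun n => mFourierCoeff f n • (mFourier n : C(UnitAddTorus (Fin d), ℂ)) := by
    refine Summable.of_norm ?_
    simpa only [norm_smul, mFourier_norm, mul_one] using ha.summable_norm
  set F : C(UnitAddTorus (Fin d), ℂ) := ∑' n, mFourierCoeff f n • mFourier n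
  have hF (t) : F t = ∑' n, mFourierCoeff f n * char γ n (cellSection γ t) := by
    simpa [char_cellSection] using (hsum.hasSum.mapL (ContinuousMap.evalCLM ℂ t)).tsum_eq.symm
  have hseries : HasSum (fun n => mFourierCoeff f n • mFourierLp 2 n)
      (ContinuousMap.toLp (E := ℂ) 2 volume ℂ F) := by
    simpa only [map_smul] using hsum.hasSum.mapL (ContinuousMap.toLp (E := ℂ) 2
      (volume : Measure (UnitAddTorus (Fin d))) ℂ)
  have hL2 := hasSum_mFourier_series_L2 (hf.toLp f)
  simp only [mFourierCoeff_coeFn_toLp] at hL2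
  filter_upwards [hf.coeFn_toLp, ContinuousMap.coeFn_toLp (𝕜 := ℂ) (p := 2) volume F] with t hft hFt
  rw [← hft, hL2.unique hseries, hFt, hF]

variable {γ} {f : Space d → ℂ}

theorem IsPeriodic.isPeriodic_fderiv (hf : IsPeriodic γ f) : IsPeriodic γ (fderiv ℝ f) := by
  intro k l hl
  rw [← fderiv_comp_add_right]
  exact congrArg (fderiv ℝ · k) (funext fun x => hf x l hl)

theorem IsPeriodic.integral_fderiv_eq_zero (hf : IsPeriodic γ f) (hf₁ : ContDiff ℝ 1 f)
    (w : Space d) : ∫ t, fderiv ℝ f (cellSection γ t) w = 0 := by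
  have hcont : Continuous fun k => fderiv ℝ f k w :=
    (hf₁.continuous_fderiv (by simp)).clm_apply continuous_const
  have hper : IsPeriodic γ fun k => fderiv ℝ f k w := hf.isPeriodic_fderiv.comp (· w)
  obtain ⟨C, hC⟩ := hper.exists_norm_le hcont
  obtain ⟨C₀, hC₀⟩ := hf.exists_norm_le hf₁.continuous
  have hline (k : Space d) (s : ℝ) : HasDerivAt (fun s : ℝ => f (k + s • w))
      (fderiv ℝ f (k + s • w) w) s := by
    have haffine : HasDerivAt (fun s : ℝ => k + s • w) w s := by
      simpa using ((hasDerivAt_id s).smul_const w).const_add k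
    exact ((hf₁.differentiable (by simp)).differentiableAt.hasFDerivAt).comp_hasDerivAt s haffine
  have hmeas (s : ℝ) : AEStronglyMeasurable (fun t => f (cellSection γ t + s • w)) volume :=
    aestronglyMeasurable_comp_cellSection γ (hf₁.continuous.comp
      (continuous_id.add continuous_const))
  have hderiv := (hasDerivAt_integral_of_dominated_loc_of_deriv_le
    (μ := (volume : Measure (UnitAddTorus (Fin d)))) (x₀ := (0 : ℝ)) (s := univ)
    (F := fun (s : ℝ) t => f (cellSection γ t + s • w))
    (F' := fun (s : ℝ) t => fderiv ℝ f (cellSection γ t + s • w) w)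
    (bound := fun _ => C) univ_mem (Eventually.of_forall hmeas)
    (Integrable.of_bound (hmeas 0) C₀ (Eventually.of_forall fun t => hC₀ _))
    (aestronglyMeasurable_comp_cellSection γ
      (f := fun k => fderiv ℝ f (k + (0 : ℝ) • w) w)
      (hcont.comp (continuous_id.add continuous_const)))
    (Eventually.of_forall fun t s _ => hC _) (integrable_const C)
    (Eventually.of_forall fun t s _ => hline _ s)).2
  have htranslate (s : ℝ) : ∫ t, f (cellSection γ t + s • w) = ∫ t, f (cellSection γ t) := by
    simp only [hf.apply_cellSection_add]
    exact integral_add_right_eq_self (fun t => f (cellSection γ t)) (toTorus γ (s • w))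
  simp only [htranslate, zero_smul, add_zero] at hderiv
  exact hderiv.unique (hasDerivAt_const _ _)

theorem IsPeriodic.hasFourierDeriv (hf : IsPeriodic γ f) (hf₁ : ContDiff ℝ 1 f) (w : Space d) :
    HasFourierDeriv (symbol γ w) (fun t => f (cellSection γ t))
      fun t => fderiv ℝ f (cellSection γ t) w := by
  intro n
  have hchar₁ : ContDiff ℝ 1 (char γ (-n)) := (contDiff_char γ (-n)).of_le (by simp)
  have hper : IsPeriodic γ fun k => char γ (-n) k * f k := fun k l hl => by
    simp only [isPeriodic_char γ (-n) k l hl, hf k l hl]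
  have hzero := hper.integral_fderiv_eq_zero (hchar₁.mul hf₁) w
  have hproduct (k : Space d) : fderiv ℝ (fun k => char γ (-n) k * f k) k w =
      char γ (-n) k * fderiv ℝ f k w - symbol γ w n * (char γ (-n) k * f k) := by
    rw [fderiv_fun_mul (hchar₁.differentiable (by simp)).differentiableAt
      (hf₁.differentiable (by simp)).differentiableAt]
    simp only [add_apply, smul_apply, smul_eq_mul, fderiv_char, map_neg]
    ring
  have hint {g : Space d → ℂ} (hg : IsPeriodic γ g) (hg' : Continuous g) :
      Integrable fun t => mFourier (-n) t * g (cellSection γ t) :=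
    integrable_mFourier_mul _ ((hg.memLp_top hg').integrable le_top)
  simp only [hproduct, char_cellSection] at hzero
  rw [integral_sub (hint (hf.isPeriodic_fderiv.comp (· w))
      ((hf₁.continuous_fderiv (by simp)).clm_apply continuous_const))
      ((hint hf hf₁.continuous).const_mul _), integral_const_mul, sub_eq_zero] at hzero
  simpa only [mFourierCoeff_eq_integral_mul] using hzero

theorem IsPeriodic.iteratedFDeriv_apply (hf : IsPeriodic γ f) (q : ℕ) (w : Space d) :
    IsPeriodic γ fun k => iteratedFDeriv ℝ q f k fun _ => w := by
  intro k l hl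
  simp only [← iteratedFDeriv_comp_add_right]
  exact congrArg (fun g => iteratedFDeriv ℝ q g k fun _ => w) (funext fun x => hf x l hl)

theorem IsPeriodic.mFourierCoeff_iteratedFDeriv (hf : IsPeriodic γ f) (hf' : ContDiff ℝ ∞ f)
    (q : ℕ) (w : Space d) (n : Fin d → ℤ) :
    mFourierCoeff (fun t => iteratedFDeriv ℝ q f (cellSection γ t) fun _ => w) n =
      symbol γ w n ^ q * mFourierCoeff (fun t => f (cellSection γ t)) n := by
  induction q with
  | zero => simp
  | succ q ih =>
    have hq : ContDiff ℝ 1 (iteratedFDeriv ℝ q f) :=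
      hf'.iteratedFDeriv_right (m := 1) (by exact_mod_cast le_top)
    have hsucc (k : Space d) : iteratedFDeriv ℝ (q + 1) f k (fun _ => w) =
        fderiv ℝ (fun k => iteratedFDeriv ℝ q f k fun _ => w) k w := by
      have happly : HasFDerivAt (fun k => iteratedFDeriv ℝ q f k fun _ => w) _ k :=
        (ContinuousMultilinearMap.apply ℝ (fun _ : Fin q => Space d) ℂ
          fun _ => w).hasFDerivAt.comp k (hq.differentiable (by simp)).differentiableAt.hasFDerivAt
      rw [iteratedFDeriv_succ_apply_left, happly.fderiv]
      rfl
    simp only [hsucc]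
    rw [(hf.iteratedFDeriv_apply q w).hasFourierDeriv
      ((ContinuousMultilinearMap.apply ℝ (fun _ : Fin q => Space d) ℂ fun _ => w).contDiff.comp hq),
      ih, pow_succ', mul_assoc]

theorem IsPeriodic.expDecay_mFourierCoeff (hf : IsPeriodic γ f) (hana : AnalyticOnNhd ℝ f univ) :
    ExpDecay fun n => mFourierCoeff (fun t => f (cellSection γ t)) n := by
  have hsmooth : ContDiff ℝ ∞ f := (contDiff_omega_iff_analyticOnNhd.mpr hana).of_le le_top
  obtain ⟨C, r, hC, hr, hbound⟩ :=
    exists_norm_iteratedFDeriv_le (isCompact_dualCell γ) (hana.mono (subset_univ _))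
  obtain ⟨K, hK, hfreq⟩ := exists_norm_le_freq γ
  refine .of_pow_mul_le (C := C) (ρ := K / r) (by positivity) fun n q => ?_
  -- The derivative along the unit vector in direction `freq γ n` has the largest symbol.
  set w : Space d := ‖freq γ n‖⁻¹ • freq γ n
  have hw : ‖w‖ ≤ 1 := by
    rw [norm_smul, norm_inv, norm_norm]
    exact inv_mul_le_one_of_le₀ (le_refl ‖freq γ n‖) (norm_nonneg _)
  have hsymbol : ‖symbol γ w n‖ = ‖freq γ n‖ := by
    rw [norm_symbol, inner_smul_right, real_inner_self_eq_norm_mul_norm, abs_of_nonneg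
      (by positivity), ← mul_assoc]
    exact inv_mul_mul_self _
  have hcoeff := norm_mFourierCoeff_le (Eventually.of_forall fun t =>
    hbound _ (cellSection_mem_dualCell γ t) q w) n
  rw [hf.mFourierCoeff_iteratedFDeriv hsmooth, norm_mul, norm_pow, hsymbol] at hcoeff
  set c := ‖mFourierCoeff (fun t => f (cellSection γ t)) n‖
  calc ‖n‖ ^ q * c ≤ (K * ‖freq γ n‖) ^ q * c := by gcongr; exact hfreq n
    _ = K ^ q * (‖freq γ n‖ ^ q * c) := by ring
    _ ≤ K ^ q * (C * q.factorial * (1 / r) ^ q) :=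
      mul_le_mul_of_nonneg_left (hcoeff.trans (by gcongr)) (by positivity)
    _ = C * q.factorial * (K / r) ^ q := by rw [div_pow, div_pow]; ring

end PeriodicFourier

/-! ### Matrix-valued functions on the torus -/

section MatrixFunctions

variable {ι κ ν : Type*} [Fintype ι]
  {M N M' N' : UnitAddTorus ι → Matrix ν ν ℂ} {p q r : ENNReal} {θ : (ι → ℤ) →+ ℂ}

/-- The entries of `M` are functions in `L^p`. Mathlib has no global norm on matrices, hence no
`MemLp` for matrix-valued functions. -/
def EntryLp (p : ENNReal) (M : UnitAddTorus ι → Matrix ν ν ℂ) : Prop :=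
  ∀ a b, MemLp (fun t => M t a b) p volume

theorem EntryLp.mul [Fintype ν] (hM : EntryLp p M) (hN : EntryLp q N) [p.HolderTriple q r] :
    EntryLp r fun t => M t * N t := by
  intro a b
  simp only [Matrix.mul_apply]
  exact memLp_finsetSum _ fun c _ => (hN c b).mul (hM a c)

theorem EntryLp.add (hM : EntryLp p M) (hN : EntryLp p N) : EntryLp p fun t => M t + N t :=
  fun a b => (hM a b).add (hN a b)

theorem EntryLp.sub (hM : EntryLp p M) (hN : EntryLp p N) : EntryLp p fun t => M t - N t :=
  fun a b => (hM a b).sub (hN a b)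

theorem EntryLp.neg (hM : EntryLp p M) : EntryLp p fun t => -M t :=
  fun a b => (hM a b).neg

theorem EntryLp.smul (c : ℝ) (hM : EntryLp p M) : EntryLp p fun t => c • M t :=
  fun a b => (hM a b).const_smul c

theorem EntryLp.sum {s : Finset κ} {H : κ → UnitAddTorus ι → Matrix ν ν ℂ}
    (hH : ∀ j, EntryLp p (H j)) : EntryLp p fun t => ∑ j ∈ s, H j t := by
  intro a b
  simp only [Matrix.sum_apply]
  exact memLp_finsetSum _ fun j _ => hH j a b

theorem EntryLp.conjTranspose (hM : EntryLp p M) : EntryLp p fun t => (M t)ᴴ :=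
  fun a b => (hM b a).star

theorem EntryLp.const (M₀ : Matrix ν ν ℂ) : EntryLp p fun _ : UnitAddTorus ι => M₀ :=
  fun a b => memLp_const (M₀ a b)

theorem EntryLp.mono (hM : EntryLp p M) (h : q ≤ p) : EntryLp q M :=
  fun a b => (hM a b).mono_exponent h

theorem EntryLp.congr_ae (hM : EntryLp p M) (h : ∀ᵐ t, M t = N t) : EntryLp p N :=
  fun a b => (memLp_congr_ae (h.mono fun t ht => by simp only [ht])).mp (hM a b)

theorem EntryLp.integrable (hM : EntryLp 1 M) (a b : ν) : Integrable fun t => M t a b :=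
  memLp_one_iff_integrable.mp (hM a b)

/-- The matrix version of `HasFourierDeriv`, entry by entry. -/
def MatFourierDeriv (θ : (ι → ℤ) →+ ℂ) (M N : UnitAddTorus ι → Matrix ν ν ℂ) : Prop :=
  ∀ a b, HasFourierDeriv θ (fun t => M t a b) fun t => N t a b

theorem MatFourierDeriv.mul [Fintype ν] (h : MatFourierDeriv θ M M')
    (k : MatFourierDeriv θ N N') (hM : EntryLp 2 M) (hN : EntryLp 2 N) (hM' : EntryLp 2 M')
    (hN' : EntryLp 2 N') :
    MatFourierDeriv θ (fun t => M t * N t) fun t => M' t * N t + M t * N' t := by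
  intro a b
  simp only [Matrix.mul_apply, Matrix.add_apply, ← Finset.sum_add_distrib]
  exact HasFourierDeriv.sum _
    (fun c _ => (h a c).mul (k c b) (hM a c) (hN c b) (hM' a c) (hN' c b))
    (fun c _ => integrable_mul_of_memLp_two (hM a c) (hN c b))
    fun c _ => (integrable_mul_of_memLp_two (hM' a c) (hN c b)).add
      (integrable_mul_of_memLp_two (hM a c) (hN' c b))

theorem MatFourierDeriv.conjTranspose (h : MatFourierDeriv θ M N) (hθ : ∀ n, conj (θ n) = -θ n) :
    MatFourierDeriv θ (fun t => (M t)ᴴ) fun t => (N t)ᴴ :=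
  fun a b => (h b a).conj hθ

theorem matFourierDeriv_const (M₀ : Matrix ν ν ℂ) :
    MatFourierDeriv θ (fun _ => M₀) fun _ : UnitAddTorus ι => 0 := by
  classical
  intro a b n
  have h := mFourierCoeff_const_mul (M₀ a b) (fun _ : UnitAddTorus ι => 1) n
  have h₀ := mFourierCoeff_const_mul 0 (fun _ : UnitAddTorus ι => 1) n
  rw [mFourierCoeff_one] at h
  simp only [mul_one, zero_mul] at h h₀
  simp only [Matrix.zero_apply, h, h₀]
  split_ifs with hn <;> simp [hn]

theorem MatFourierDeriv.congr_ae_left (h : MatFourierDeriv θ M M') (hN : ∀ᵐ t, M t = N t) :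
    MatFourierDeriv θ N M' :=
  fun a b n => (h a b n).trans (congrArg (θ n * ·)
    (mFourierCoeff_congr_ae (hN.mono fun t ht => by simp only [ht]) n))

theorem MatFourierDeriv.ae_eq [Finite ν] (h : MatFourierDeriv θ M M') (k : MatFourierDeriv θ M N')
    (hM' : EntryLp 2 M') (hN' : EntryLp 2 N') : ∀ᵐ t, M' t = N' t := by
  have hentries : ∀ᵐ t, ∀ a b, M' t a b = N' t a b := by
    simp only [ae_all_iff]
    exact fun a b => (h a b).ae_eq (k a b) (hM' a b) (hN' a b)
  exact hentries.mono fun t ht => Matrix.ext ht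

variable [Fintype κ] {Θ : κ → (ι → ℤ) →+ ℂ} {H H' : κ → UnitAddTorus ι → Matrix ν ν ℂ}
  {R R' : UnitAddTorus ι → Matrix ν ν ℂ}

/-- The matrix version of `HasFourierDiv`, entry by entry. -/
def MatFourierDiv (Θ : κ → (ι → ℤ) →+ ℂ) (H : κ → UnitAddTorus ι → Matrix ν ν ℂ)
    (R : UnitAddTorus ι → Matrix ν ν ℂ) : Prop :=
  ∀ a b, HasFourierDiv Θ (fun j t => H j t a b) fun t => R t a b

theorem MatFourierDiv.congr_ae (h : MatFourierDiv Θ H R) (hR : ∀ᵐ t, R t = R' t) :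
    MatFourierDiv Θ H R' :=
  fun a b => (h a b).congr_ae (hR.mono fun t ht => by simp only [ht])

theorem MatFourierDiv.add (h : MatFourierDiv Θ H R) (h' : MatFourierDiv Θ H' R')
    (hH : ∀ j, EntryLp 2 (H j)) (hH' : ∀ j, EntryLp 2 (H' j)) (hR : EntryLp 1 R)
    (hR' : EntryLp 1 R') : MatFourierDiv Θ (fun j t => H j t + H' j t) fun t => R t + R' t :=
  fun a b => (h a b).add (h' a b) (fun j => (hH j a b).integrable (by norm_num))
    (fun j => (hH' j a b).integrable (by norm_num)) (hR.integrable a b) (hR'.integrable a b)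

theorem matFourierDiv_of_matFourierDeriv (h : ∀ j, MatFourierDeriv (Θ j) (H j) (H' j))
    (hH' : ∀ j, EntryLp 1 (H' j)) : MatFourierDiv Θ H fun t => ∑ j, H' j t := by
  intro a b
  simp only [Matrix.sum_apply]
  exact hasFourierDiv_of_hasFourierDeriv (fun j => h j a b) fun j => (hH' j).integrable a b

theorem MatFourierDiv.mul_of_bounded [Fintype ν] (h : MatFourierDiv Θ H R)
    {V : UnitAddTorus ι → Matrix ν ν ℂ} {DV : κ → UnitAddTorus ι → Matrix ν ν ℂ}
    (hV : EntryLp ⊤ V) (hDV : ∀ j, EntryLp 2 (DV j))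
    (hderiv : ∀ j, MatFourierDeriv (Θ j) V (DV j)) (hH : ∀ j, EntryLp 2 (H j))
    (hR : EntryLp 1 R) :
    MatFourierDiv Θ (fun j t => V t * H j t) fun t => V t * R t + ∑ j, DV j t * H j t := by
  intro a b
  simp only [Matrix.add_apply, Matrix.sum_apply, Matrix.mul_apply]
  simp only [Finset.sum_comm (s := (Finset.univ : Finset κ)), ← Finset.sum_add_distrib]
  have hVH (c : ν) (j : κ) : Integrable fun t => V t a c * H j t c b :=
    integrable_mul_of_memLp_two ((hV a c).mono_exponent le_top) (hH j c b)
  have hVR (c : ν) : Integrable fun t => V t a c * R t c b :=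
    memLp_one_iff_integrable.mp ((hR c b).mul (hV a c))
  have hDVH (c : ν) (j : κ) : Integrable fun t => DV j t a c * H j t c b :=
    integrable_mul_of_memLp_two (hDV j a c) (hH j c b)
  exact HasFourierDiv.sum _
    (fun c _ => (h c b).mul_of_bounded (hV a c) (fun j => hDV j a c) (fun j => hderiv j a c)
      (fun j => hH j c b) (hR.integrable c b))
    (fun c _ j => hVH c j) fun c _ => (hVR c).add (integrable_finsetSum _ fun j _ => hDVH c j)

end MatrixFunctions

/-! ### The Euler-Lagrange equation in divergence form -/

section MatrixIdentities

variable {ν : Type*} [Fintype ν] [DecidableEq ν] {s : ℝ} {U D A A' G : Matrix ν ν ℂ}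

/-- The connection `U*(D + A U)` into which the gauge `U` with derivative `D` transforms `A`. -/
def gaugeConnection (U D A : Matrix ν ν ℂ) : Matrix ν ν ℂ := Uᴴ * (D + A * U)

/-- The pointwise expression in `lowerOrder`, with `D`, `A'` and `G` standing for `∂_jU`, `∂_jA_j`
and `G^j`. -/
def lowerTerm (s : ℝ) (U D A A' G : Matrix ν ν ℂ) : Matrix ν ν ℂ :=
  D * U⁻¹ * D + (D * U⁻¹ * A * U - A' * U - A * D)
    + s • (-((D + A * U) * G) + U * G * U⁻¹ * (D + A * U))

theorem inv_eq_conjTranspose_of_mem_unitaryGroup (hU : U ∈ Matrix.unitaryGroup ν ℂ) : U⁻¹ = Uᴴ :=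
  Matrix.inv_eq_right_inv (Matrix.mem_unitaryGroup_iff.mp hU)

theorem mul_gaugeConnection (hU : U ∈ Matrix.unitaryGroup ν ℂ) :
    U * gaugeConnection U D A = D + A * U := by
  rw [gaugeConnection, ← Matrix.mul_assoc, ← Matrix.star_eq_conjTranspose,
    Matrix.mem_unitaryGroup_iff.mp hU, Matrix.one_mul]

theorem conjTranspose_mul_lowerTerm_add (hU : U ∈ Matrix.unitaryGroup ν ℂ)
    (hD : Dᴴ = -(Uᴴ * D * Uᴴ)) :
    Uᴴ * (lowerTerm s U D A A' G + (A' * U + A * D)) + Dᴴ * (D + A * U) =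
      s • (G * gaugeConnection U D A - gaugeConnection U D A * G) := by
  have hcancel (X : Matrix ν ν ℂ) : Uᴴ * (U * X) = X := by
    rw [← Matrix.mul_assoc, ← Matrix.star_eq_conjTranspose, Matrix.mem_unitaryGroup_iff'.mp hU,
      Matrix.one_mul]
  rw [lowerTerm, gaugeConnection, inv_eq_conjTranspose_of_mem_unitaryGroup hU, hD]
  simp only [Matrix.mul_add, Matrix.mul_sub, Matrix.mul_smul, Matrix.mul_neg, Matrix.neg_mul,
    Matrix.add_mul, Matrix.mul_assoc, hcancel, smul_add, smul_neg, smul_sub]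
  abel

end MatrixIdentities

section EulerLagrange

variable {ι κ ν : Type*} [Fintype ι] [Fintype ν] [DecidableEq ν]
  {θ : κ → (ι → ℤ) →+ ℂ} {U : UnitAddTorus ι → Matrix ν ν ℂ}
  {D A A' : κ → UnitAddTorus ι → Matrix ν ν ℂ} {G : κ → Matrix ν ν ℂ} {s : ℝ}

/-- `U` is a map of class `W^{1,2}` from the torus to the unitary group, and `D j` is its
derivative with Fourier symbol `θ j`. -/
structure IsUnitaryGauge (θ : κ → (ι → ℤ) →+ ℂ) (U : UnitAddTorus ι → Matrix ν ν ℂ)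
    (D : κ → UnitAddTorus ι → Matrix ν ν ℂ) : Prop where
  mem_unitaryGroup : ∀ᵐ t, U t ∈ Matrix.unitaryGroup ν ℂ
  entryLp : EntryLp 2 U
  entryLp_deriv : ∀ j, EntryLp 2 (D j)
  fourierDeriv : ∀ j, MatFourierDeriv (θ j) U (D j)

/-- The connection matrices `A j` are bounded, and so are their derivatives `A' j` with Fourier
symbol `θ j`. -/
structure IsBoundedConnection (θ : κ → (ι → ℤ) →+ ℂ)
    (A A' : κ → UnitAddTorus ι → Matrix ν ν ℂ) : Prop where
  entryLp : ∀ j, EntryLp ⊤ (A j)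
  entryLp_deriv : ∀ j, EntryLp ⊤ (A' j)
  fourierDeriv : ∀ j, MatFourierDeriv (θ j) (A j) (A' j)

theorem IsUnitaryGauge.entryLp_top (h : IsUnitaryGauge θ U D) : EntryLp ⊤ U :=
  fun a b => memLp_top_of_bound (h.entryLp a b).1 1
    (h.mem_unitaryGroup.mono fun _ ht => entry_norm_bound_of_unitary ht a b)

theorem IsUnitaryGauge.conjTranspose_deriv_ae (h : IsUnitaryGauge θ U D)
    (hθ : ∀ j n, conj (θ j n) = -θ j n) (j : κ) :
    ∀ᵐ t, (D j t)ᴴ = -((U t)ᴴ * D j t * (U t)ᴴ) := by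
  have hprod : MatFourierDeriv (θ j) (fun t => (U t)ᴴ * U t)
      fun t => (D j t)ᴴ * U t + (U t)ᴴ * D j t :=
    ((h.fourierDeriv j).conjTranspose (hθ j)).mul (h.fourierDeriv j) h.entryLp.conjTranspose
      h.entryLp (h.entryLp_deriv j).conjTranspose (h.entryLp_deriv j)
  have hone : MatFourierDeriv (θ j) (fun t => (U t)ᴴ * U t) fun _ => 0 :=
    (matFourierDeriv_const 1).congr_ae_left
      (h.mem_unitaryGroup.mono fun t ht => (Matrix.mem_unitaryGroup_iff'.mp ht).symm)
  have hzero := hprod.ae_eq hone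
    (((h.entryLp_deriv j).conjTranspose.mul h.entryLp_top).add
      (h.entryLp_top.conjTranspose.mul (h.entryLp_deriv j))) (EntryLp.const 0)
  filter_upwards [hzero, h.mem_unitaryGroup] with t hzero_t hU
  calc (D j t)ᴴ = (D j t)ᴴ * U t * (U t)ᴴ := by
        rw [Matrix.mul_assoc, ← Matrix.star_eq_conjTranspose (U t),
          Matrix.mem_unitaryGroup_iff.mp hU, Matrix.mul_one]
    _ = -((U t)ᴴ * D j t * (U t)ᴴ) := by rw [eq_neg_of_add_eq_zero_left hzero_t, Matrix.neg_mul]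

theorem IsUnitaryGauge.entryLp_deriv_add (h : IsUnitaryGauge θ U D)
    {A₀ : UnitAddTorus ι → Matrix ν ν ℂ} (hA : EntryLp ⊤ A₀) (j : κ) :
    EntryLp 2 fun t => D j t + A₀ t * U t :=
  (h.entryLp_deriv j).add (hA.mul h.entryLp)

theorem IsUnitaryGauge.entryLp_gaugeConnection (h : IsUnitaryGauge θ U D)
    {A₀ : UnitAddTorus ι → Matrix ν ν ℂ} (hA : EntryLp ⊤ A₀) (j : κ) :
    EntryLp 2 fun t => gaugeConnection (U t) (D j t) (A₀ t) :=
  h.entryLp_top.conjTranspose.mul (h.entryLp_deriv_add hA j)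

theorem IsUnitaryGauge.entryLp_lowerTerm (h : IsUnitaryGauge θ U D)
    (hA : IsBoundedConnection θ A A') (G₀ : Matrix ν ν ℂ) (j : κ) :
    EntryLp 1 fun t => lowerTerm s (U t) (D j t) (A j t) (A' j t) G₀ := by
  have hU := h.entryLp_top
  have hD := h.entryLp_deriv j
  have hinv : EntryLp ⊤ fun t => (U t)⁻¹ := hU.conjTranspose.congr_ae
    (h.mem_unitaryGroup.mono fun t ht => (inv_eq_conjTranspose_of_mem_unitaryGroup ht).symm)
  have hDinv : EntryLp 2 fun t => D j t * (U t)⁻¹ := hD.mul hinv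
  have hDinvA : EntryLp 2 fun t => D j t * (U t)⁻¹ * A j t := hDinv.mul (hA.entryLp j)
  have hG : EntryLp ⊤ fun _ : UnitAddTorus ι => G₀ := EntryLp.const G₀
  have hE := h.entryLp_deriv_add (hA.entryLp j) j
  have hUG : EntryLp ⊤ fun t => U t * G₀ := hU.mul hG
  have hUGinv : EntryLp ⊤ fun t => U t * G₀ * (U t)⁻¹ := hUG.mul hinv
  have hlinear : EntryLp 2 fun t => D j t * (U t)⁻¹ * A j t * U t - A' j t * U t - A j t * D j t :=
    ((hDinvA.mul hU).sub ((hA.entryLp_deriv j).mul h.entryLp)).sub ((hA.entryLp j).mul hD)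
  have hmean : EntryLp 2 fun t => -((D j t + A j t * U t) * G₀) +
      U t * G₀ * (U t)⁻¹ * (D j t + A j t * U t) := (hE.mul hG).neg.add (hUGinv.mul hE)
  exact ((hDinv.mul hD).add (hlinear.mono one_le_two)).add ((hmean.smul s).mono one_le_two)

theorem IsUnitaryGauge.entryLp_deriv_mul (h : IsUnitaryGauge θ U D)
    (hA : IsBoundedConnection θ A A') (j : κ) :
    EntryLp 2 fun t => A' j t * U t + A j t * D j t :=
  ((hA.entryLp_deriv j).mul h.entryLp).add ((hA.entryLp j).mul (h.entryLp_deriv j))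

variable [Fintype κ]

theorem IsUnitaryGauge.matFourierDiv_deriv_add (h : IsUnitaryGauge θ U D)
    (hA : IsBoundedConnection θ A A')
    (hEL : MatFourierDiv θ D fun t => ∑ j, lowerTerm s (U t) (D j t) (A j t) (A' j t) (G j)) :
    MatFourierDiv θ (fun j t => D j t + A j t * U t) fun t =>
      ∑ j, (lowerTerm s (U t) (D j t) (A j t) (A' j t) (G j) +
        (A' j t * U t + A j t * D j t)) := by
  have hAU' (j : κ) := (h.entryLp_deriv_mul hA j).mono one_le_two
  have hdivAU := matFourierDiv_of_matFourierDeriv (fun j => (hA.fourierDeriv j).mul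
    (h.fourierDeriv j) ((hA.entryLp j).mono le_top) h.entryLp ((hA.entryLp_deriv j).mono le_top)
    (h.entryLp_deriv j)) hAU'
  simpa only [Finset.sum_add_distrib] using hEL.add hdivAU h.entryLp_deriv
    (fun j => (hA.entryLp j).mul h.entryLp) (EntryLp.sum fun j => h.entryLp_lowerTerm hA (G j) j)
    (EntryLp.sum hAU')

theorem IsUnitaryGauge.matFourierDiv_gaugeConnection (h : IsUnitaryGauge θ U D)
    (hθ : ∀ j n, conj (θ j n) = -θ j n) (hA : IsBoundedConnection θ A A')
    (hEL : MatFourierDiv θ D fun t => ∑ j, lowerTerm s (U t) (D j t) (A j t) (A' j t) (G j)) :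
    MatFourierDiv θ (fun j t => gaugeConnection (U t) (D j t) (A j t)) fun t =>
      ∑ j, s • (G j * gaugeConnection (U t) (D j t) (A j t) -
        gaugeConnection (U t) (D j t) (A j t) * G j) := by
  have hAU' (j : κ) := (h.entryLp_deriv_mul hA j).mono one_le_two
  have hdiv := (h.matFourierDiv_deriv_add hA hEL).mul_of_bounded h.entryLp_top.conjTranspose
    (fun j => (h.entryLp_deriv j).conjTranspose) (fun j => (h.fourierDeriv j).conjTranspose (hθ j))
    (fun j => h.entryLp_deriv_add (hA.entryLp j) j)
    (EntryLp.sum fun j => (h.entryLp_lowerTerm hA (G j) j).add (hAU' j))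
  refine hdiv.congr_ae ?_
  filter_upwards [h.mem_unitaryGroup, ae_all_iff.mpr (h.conjTranspose_deriv_ae hθ)] with t hU hD
  rw [Finset.mul_sum, ← Finset.sum_add_distrib]
  exact Finset.sum_congr rfl fun j _ => conjTranspose_mul_lowerTerm_add hU (hD j)

end EulerLagrange

/-! ### Linear systems with exponentially decaying coefficients -/

section LinearSystem

variable {ι κ σ : Type*} [Fintype ι] [Fintype κ] [Fintype σ]

theorem norm_mFourierCoeff_mul_le {f g : UnitAddTorus ι → ℂ} (hf : MemLp f 2 volume)
    (hg : MemLp g 2 volume) {k β : (ι → ℤ) → ℝ} (hk : ∀ n, ‖mFourierCoeff f n‖ ≤ k n)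
    (hβ : ∀ n, ‖mFourierCoeff g n‖ ≤ β n) {n : ι → ℤ} (hsum : Summable fun m => k m * β (n - m)) :
    ‖mFourierCoeff (fun t => f t * g t) n‖ ≤ ∑' m, k m * β (n - m) := by
  rw [← (hasSum_mFourierCoeff_mul hf hg n).tsum_eq]
  exact tsum_of_norm_bounded hsum.hasSum fun m => norm_mul_le_of_le (hk m) (hβ (n - m))

theorem expDecay_mFourierCoeff_mul_sub_mul {f g : UnitAddTorus ι → ℂ} (hf : Integrable f)
    (hg : Integrable g) (hf_decay : ExpDecay (mFourierCoeff f))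
    (hg_decay : ExpDecay (mFourierCoeff g)) (c c' : ℂ) :
    ExpDecay (mFourierCoeff fun t => f t * c - c' * g t) := by
  have hcf : ExpDecay fun n => c * mFourierCoeff f n :=
    hf_decay.of_norm_le (K := ‖c‖) fun n => norm_mul_le _ _
  have hcg : ExpDecay fun n => -(c' * mFourierCoeff g n) :=
    hg_decay.of_norm_le (K := ‖c'‖) fun n => by rw [norm_neg, norm_mul]
  refine (hcf.add hcg).of_norm_le (K := 1) fun n => le_of_eq ?_
  simp only [mul_comm _ c]
  rw [mFourierCoeff_sub (hf.const_mul c) (hg.const_mul c'), mFourierCoeff_const_mul,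
    mFourierCoeff_const_mul, one_mul, sub_eq_add_neg]

theorem HasFourierDeriv.norm_mul_norm_le {θ : (ι → ℤ) →+ ℂ} {u : UnitAddTorus ι → ℂ}
    {M v : σ → UnitAddTorus ι → ℂ} (h : HasFourierDeriv θ u fun t => ∑ b, M b t * v b t)
    (hM : ∀ b, MemLp (M b) 2 volume) (hv : ∀ b, MemLp (v b) 2 volume) {k β : (ι → ℤ) → ℝ}
    (hk : ∀ b n, ‖mFourierCoeff (M b) n‖ ≤ k n) (hβ : ∀ b n, ‖mFourierCoeff (v b) n‖ ≤ β n)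
    {n : ι → ℤ} (hsum : Summable fun m => k m * β (n - m)) :
    ‖θ n‖ * ‖mFourierCoeff u n‖ ≤ Fintype.card σ * ∑' m, k m * β (n - m) := by
  rw [← norm_mul, ← h n, mFourierCoeff_sum _ fun b _ => integrable_mul_of_memLp_two (hM b) (hv b)]
  simpa using norm_sum_le_of_le Finset.univ fun b _ =>
    norm_mFourierCoeff_mul_le (hM b) (hv b) (hk b) (hβ b) hsum

theorem ExpDecay.of_norm_mul_le_conv {β : (ι → ℤ) → ℝ} {B C ε : ℝ} (hC : 0 ≤ C) (hε : 0 < ε)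
    (hβ_nonneg : ∀ n, 0 ≤ β n) (hβ_le : ∀ n, β n ≤ B)
    (h : ∀ n, ‖n‖ * β n ≤ ∑' m, C * Real.exp (-(ε * ‖m‖)) * β (n - m)) : ExpDecay β := by
  have hkernel : Summable fun m : ι → ℤ =>
      Real.exp (ε / 2 * ‖m‖) * (C * Real.exp (-(ε * ‖m‖))) := by
    refine ((summable_exp_neg_mul_norm (half_pos hε)).mul_left C).congr fun m => ?_
    rw [show -(ε / 2 * ‖m‖) = ε / 2 * ‖m‖ + -(ε * ‖m‖) by ring, Real.exp_add]
    ring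
  obtain ⟨C', hC', hexp⟩ := exists_le_exp_of_norm_mul_le_conv (half_pos hε).le hβ_nonneg hβ_le
    (fun m => by positivity) hkernel h
  exact ⟨C', ε / 2, hC', half_pos hε, fun n =>
    (Real.norm_of_nonneg (hβ_nonneg n)).trans_le (hexp n)⟩

/-- Since the symbols control `‖n‖`, the product `‖n‖ ∑ ‖û_a(n)‖` is bounded by the convolution of
`∑ ‖û_a‖` with an exponentially decaying kernel. -/
theorem expDecay_of_linear_system {θ : κ → (ι → ℤ) →+ ℂ} {K : ℝ} (hK : 0 ≤ K)
    (hθ : ∀ n, ‖n‖ ≤ K * ∑ j, ‖θ j n‖) {u : σ → UnitAddTorus ι → ℂ}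
    {M : κ → σ → σ → UnitAddTorus ι → ℂ} (hu : ∀ a, MemLp (u a) 2 volume)
    (hM : ∀ j a b, MemLp (M j a b) 2 volume) (hdecay : ∀ j a b, ExpDecay (mFourierCoeff (M j a b)))
    (hderiv : ∀ j a, HasFourierDeriv (θ j) (u a) fun t => ∑ b, M j a b t * u b t) (a : σ) :
    ExpDecay (mFourierCoeff (u a)) := by
  obtain ⟨C, ε, hC, hε, hbound⟩ := ExpDecay.exists_common
    (a := fun p : κ × σ × σ => mFourierCoeff (M p.1 p.2.1 p.2.2)) fun p => hdecay p.1 p.2.1 p.2.2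
  set β : (ι → ℤ) → ℝ := fun n => ∑ a, ‖mFourierCoeff (u a) n‖ with hβ
  have hβ_nonneg (n : ι → ℤ) : 0 ≤ β n := Finset.sum_nonneg fun a _ => norm_nonneg _
  have hle (a : σ) (n : ι → ℤ) : ‖mFourierCoeff (u a) n‖ ≤ β n :=
    Finset.single_le_sum (f := fun a => ‖mFourierCoeff (u a) n‖) (fun _ _ => norm_nonneg _)
      (Finset.mem_univ a)
  have hβ_le (n : ι → ℤ) : β n ≤ ∑ a, ∫ t, ‖u a t‖ :=
    Finset.sum_le_sum fun a _ => norm_mFourierCoeff_le_integral _ n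
  have hconv (n : ι → ℤ) : Summable fun m => C * Real.exp (-(ε * ‖m‖)) * β (n - m) :=
    Summable.of_nonneg_of_le (fun m => mul_nonneg (by positivity) (hβ_nonneg _))
      (fun m => mul_le_mul_of_nonneg_left (hβ_le _) (by positivity))
      (((summable_exp_neg_mul_norm hε).mul_left C).mul_right _)
  have hsystem (j : κ) (a : σ) (n : ι → ℤ) := (hderiv j a).norm_mul_norm_le (hM j a) hu
    (fun b => hbound (j, a, b)) hle (hconv n)
  have hβ_decay : ExpDecay β := by
    refine ExpDecay.of_norm_mul_le_conv
      (C := K * (Fintype.card κ * (Fintype.card σ * (Fintype.card σ * C)))) (by positivity) hε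
      hβ_nonneg hβ_le fun n => ?_
    calc ‖n‖ * β n ≤ (K * ∑ j, ‖θ j n‖) * β n := mul_le_mul_of_nonneg_right (hθ n) (hβ_nonneg n)
      _ = K * ∑ j, ∑ a, ‖θ j n‖ * ‖mFourierCoeff (u a) n‖ := by
        rw [mul_assoc, hβ, Finset.sum_mul_sum]
      _ ≤ K * ∑ _j : κ, ∑ _a : σ,
            Fintype.card σ * ∑' m, C * Real.exp (-(ε * ‖m‖)) * β (n - m) :=
        mul_le_mul_of_nonneg_left
          (Finset.sum_le_sum fun j _ => Finset.sum_le_sum fun a _ => hsystem j a n) hK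
      _ = _ := by
        simp only [Finset.sum_const, Finset.card_univ, nsmul_eq_mul, mul_assoc, tsum_mul_left]
  exact hβ_decay.of_norm_le (K := 1) fun n => by
    rw [one_mul, Real.norm_of_nonneg (hβ_nonneg n)]
    exact hle a n

end LinearSystem

/-! ### Exponential decay of the gauge -/

section AlgebraicDecay

variable {G κ : Type*} [NormedAddCommGroup G] [Fintype κ]

theorem ExpDecay.of_symbol_mul_eq {θ : G →+ ℂ} (hθ : Function.Injective θ) {a : G → ℂ} {z : ℂ}
    (h : ∀ n, θ n * a n = z * a n) : ExpDecay a := by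
  have hsupport (n : G) (hn : a n ≠ 0) : θ n = z := mul_right_cancel₀ hn (h n)
  have hfinite : {n | a n ≠ 0}.Finite :=
    ((finite_singleton z).preimage hθ.injOn).subset hsupport
  exact ExpDecay.of_finite_support (s := hfinite.toFinset) fun n hn => by simpa using hn

/-- The curl equations make `x` parallel to `z`, and the divergence equation makes `x + α`
orthogonal to `z`. -/
theorem norm_le_sum_norm_of_curl_div {z x α : κ → ℂ} (hz : z ≠ 0) (hskew : ∀ i, conj (z i) = -z i)
    (hcurl : ∀ i j, z i * x j = z j * x i) (hdiv : ∑ i, z i * (x i + α i) = 0) (j : κ) :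
    ‖x j‖ ≤ ∑ i, ‖α i‖ := by
  obtain ⟨i, hi⟩ := Function.ne_iff.mp hz
  set X : EuclideanSpace ℂ κ := WithLp.toLp 2 x with hX
  set Y : EuclideanSpace ℂ κ := WithLp.toLp 2 α with hY
  have hparallel (l : κ) : x l = x i / z i * z l := by
    have hzi : z i ≠ 0 := hi
    field_simp
    linear_combination hcurl i l
  have horthogonal : ⟪X, X + Y⟫_ℂ = 0 := by
    have hterm (l : κ) : (x l + α l) * conj (x l) = -conj (x i / z i) * (z l * (x l + α l)) := by
      rw [hparallel l, map_mul, hskew]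
      ring
    simp only [PiLp.inner_apply, RCLike.inner_apply, PiLp.add_apply, hX, hY, hterm,
      ← Finset.mul_sum, hdiv, mul_zero]
  have hpythagoras : ‖X‖ * ‖X‖ + ‖X + Y‖ * ‖X + Y‖ = ‖Y‖ * ‖Y‖ := by
    have h := norm_add_sq_eq_norm_sq_add_norm_sq_of_inner_eq_zero (𝕜 := ℂ) (-X) (X + Y)
      (by rw [inner_neg_left, horthogonal, neg_zero])
    rw [neg_add_cancel_left, norm_neg] at h
    exact h.symm
  calc ‖x j‖ ≤ ‖X‖ := PiLp.norm_apply_le X j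
    _ ≤ ‖Y‖ := by
      refine abs_le_of_sq_le_sq' ?_ (norm_nonneg _) |>.2
      nlinarith [mul_self_nonneg ‖X + Y‖]
    _ ≤ ∑ i, ‖α i‖ := by
      classical
      conv_lhs => rw [← (EuclideanSpace.basisFun κ ℂ).sum_repr Y]
      refine norm_sum_le_of_le _ fun l _ => ?_
      simp [norm_smul, hY]

theorem expDecay_of_curl_div {θ : κ → G →+ ℂ} (hskew : ∀ j n, conj (θ j n) = -θ j n)
    (hker : ∀ n, (∀ j, θ j n = 0) → n = 0) {x α : κ → G → ℂ} (hα : ∀ j, ExpDecay (α j))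
    (hcurl : ∀ i j n, θ i n * x j n = θ j n * x i n)
    (hdiv : ∀ n, ∑ j, θ j n * (x j n + α j n) = 0) (j : κ) : ExpDecay (x j) := by
  classical
  have horigin : ExpDecay fun n => if n = 0 then ‖x j n‖ else 0 :=
    ExpDecay.of_finite_support (s := {0}) fun n hn => if_neg (by simpa using hn)
  have hα_sum : ExpDecay fun n => ∑ i, ‖α i n‖ :=
    ExpDecay.sum fun i => (hα i).of_norm_le (K := 1) fun n => by simp
  refine (horigin.add hα_sum).of_norm_le (K := 1) fun n => ?_
  have hα_nonneg : 0 ≤ ∑ i, ‖α i n‖ := Finset.sum_nonneg fun i _ => norm_nonneg _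
  rw [one_mul]
  refine le_trans ?_ (Real.le_norm_self _)
  split_ifs with hn
  · exact le_add_of_nonneg_right hα_nonneg
  · rw [zero_add]
    exact norm_le_sum_norm_of_curl_div (z := fun j => θ j n)
      (fun hz => hn (hker n (congrFun hz))) (fun i => hskew i n) (fun i j => hcurl i j n) (hdiv n) j

end AlgebraicDecay

section SubsingletonMatrix

variable {ν : Type*} [Fintype ν] [Subsingleton ν]

theorem matrix_mul_apply_of_subsingleton (M N : Matrix ν ν ℂ) (a b : ν) :
    (M * N) a b = M a b * N a b := by
  rw [Matrix.mul_apply, Fintype.sum_subsingleton _ a, Subsingleton.elim b a]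

theorem matrix_mul_comm_of_subsingleton (M N : Matrix ν ν ℂ) : M * N = N * M := by
  ext a b
  rw [matrix_mul_apply_of_subsingleton, matrix_mul_apply_of_subsingleton, mul_comm]

end SubsingletonMatrix

section GaugeDecay

variable {ι κ ν : Type*} [Fintype ι] [Fintype ν] [DecidableEq ν]
  {θ : κ → (ι → ℤ) →+ ℂ} {U : UnitAddTorus ι → Matrix ν ν ℂ}
  {D A A' : κ → UnitAddTorus ι → Matrix ν ν ℂ} {s : ℝ}

theorem IsUnitaryGauge.expDecay_gaugeConnection_of_injective [Fintype κ] [Subsingleton κ]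
    (h : IsUnitaryGauge θ U D) (hskew : ∀ j n, conj (θ j n) = -θ j n)
    (hinj : ∀ j, Function.Injective (θ j)) (hA : IsBoundedConnection θ A A') {g : κ → ν → ℂ}
    (hEL : MatFourierDiv θ D fun t =>
      ∑ j, lowerTerm s (U t) (D j t) (A j t) (A' j t) (Matrix.diagonal (g j)))
    (j : κ) (a b : ν) :
    ExpDecay (mFourierCoeff fun t => gaugeConnection (U t) (D j t) (A j t) a b) := by
  refine ExpDecay.of_symbol_mul_eq (hinj j) (z := s * (g j a - g j b)) fun n => ?_
  have hdiv := h.matFourierDiv_gaugeConnection hskew hA hEL a b n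
  beta_reduce at hdiv
  rw [Fintype.sum_subsingleton _ j] at hdiv
  rw [hdiv, ← mFourierCoeff_const_mul]
  refine congrArg (mFourierCoeff · n) (funext fun t => ?_)
  rw [Fintype.sum_subsingleton _ j, Matrix.smul_apply, Matrix.sub_apply, Matrix.diagonal_mul,
    Matrix.mul_diagonal, Complex.real_smul]
  ring

theorem IsUnitaryGauge.symbol_mul_conjTranspose_mul_deriv_comm [Subsingleton ν]
    (h : IsUnitaryGauge θ U D) (hskew : ∀ j n, conj (θ j n) = -θ j n) (i j : κ) (a b : ν)
    (n : ι → ℤ) :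
    θ i n * mFourierCoeff (fun t => ((U t)ᴴ * D j t) a b) n =
      θ j n * mFourierCoeff (fun t => ((U t)ᴴ * D i t) a b) n := by
  have hcurl := mFourierCoeff_curl_mul (h.entryLp.conjTranspose a b)
    ((h.entryLp_deriv i).conjTranspose a b) ((h.entryLp_deriv j).conjTranspose a b)
    (h.entryLp_deriv i a b) (h.entryLp_deriv j a b)
    ((h.fourierDeriv i).conjTranspose (hskew i) a b)
    ((h.fourierDeriv j).conjTranspose (hskew j) a b) (h.fourierDeriv i a b) (h.fourierDeriv j a b) n
  have hsymm : (fun t => (D i t)ᴴ a b * D j t a b) =ᵐ[volume]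
      fun t => (D j t)ᴴ a b * D i t a b := by
    filter_upwards [h.conjTranspose_deriv_ae hskew i, h.conjTranspose_deriv_ae hskew j]
      with t hi hj
    simp only [hi, hj, Matrix.neg_apply, matrix_mul_apply_of_subsingleton]
    ring
  rw [mFourierCoeff_congr_ae hsymm, sub_self, sub_eq_zero] at hcurl
  simpa only [matrix_mul_apply_of_subsingleton] using hcurl

theorem IsUnitaryGauge.mFourierCoeff_gaugeConnection_of_subsingleton [Subsingleton ν]
    (h : IsUnitaryGauge θ U D) {j : κ} (hA : EntryLp ⊤ (A j)) (a b : ν) (n : ι → ℤ) :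
    mFourierCoeff (fun t => gaugeConnection (U t) (D j t) (A j t) a b) n =
      mFourierCoeff (fun t => ((U t)ᴴ * D j t) a b) n + mFourierCoeff (fun t => A j t a b) n := by
  have hX : EntryLp 2 fun t => (U t)ᴴ * D j t := h.entryLp_top.conjTranspose.mul (h.entryLp_deriv j)
  rw [← mFourierCoeff_add ((hX.mono one_le_two).integrable a b) ((hA.mono le_top).integrable a b)]
  refine mFourierCoeff_congr_ae (h.mem_unitaryGroup.mono fun t ht => ?_) n
  have hgauge : gaugeConnection (U t) (D j t) (A j t) = (U t)ᴴ * D j t + A j t := by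
    rw [gaugeConnection, Matrix.mul_add, matrix_mul_comm_of_subsingleton (A j t),
      ← Matrix.mul_assoc, ← Matrix.star_eq_conjTranspose, Matrix.mem_unitaryGroup_iff'.mp ht,
      Matrix.one_mul]
  simp only [hgauge, Matrix.add_apply]

theorem IsUnitaryGauge.expDecay_gaugeConnection_of_subsingleton [Fintype κ] [Subsingleton ν]
    (h : IsUnitaryGauge θ U D) (hskew : ∀ j n, conj (θ j n) = -θ j n)
    (hker : ∀ n, (∀ j, θ j n = 0) → n = 0) (hA : IsBoundedConnection θ A A')
    (hA_decay : ∀ j a b, ExpDecay (mFourierCoeff fun t => A j t a b)) {G : κ → Matrix ν ν ℂ}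
    (hEL : MatFourierDiv θ D fun t => ∑ j, lowerTerm s (U t) (D j t) (A j t) (A' j t) (G j))
    (j : κ) (a b : ν) :
    ExpDecay (mFourierCoeff fun t => gaugeConnection (U t) (D j t) (A j t) a b) := by
  have hgauge (j : κ) := h.mFourierCoeff_gaugeConnection_of_subsingleton (hA.entryLp j) a b
  have hdiv (n : ι → ℤ) : ∑ j, θ j n * (mFourierCoeff (fun t => ((U t)ᴴ * D j t) a b) n +
      mFourierCoeff (fun t => A j t a b) n) = 0 := by
    simp only [← hgauge]
    refine (h.matFourierDiv_gaugeConnection hskew hA hEL a b n).trans ?_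
    simp only [matrix_mul_comm_of_subsingleton (G _), sub_self, smul_zero, Finset.sum_const_zero,
      Matrix.zero_apply]
    simpa using mFourierCoeff_const_mul 0 (fun _ : UnitAddTorus ι => 1) n
  have hX := expDecay_of_curl_div hskew hker (fun j => hA_decay j a b)
    (fun i j n => h.symbol_mul_conjTranspose_mul_deriv_comm hskew i j a b n) hdiv j
  exact (hX.add (hA_decay j a b)).of_norm_le (K := 1) fun n => by rw [hgauge, one_mul]

/-- `∂_jU = U B_j - A_j U` is a linear system for `U` once the gauge transforms `B_j` of the
connection matrices `A_j` are known. -/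
theorem IsUnitaryGauge.expDecay_of_gaugeConnection [Fintype κ] {K : ℝ} (hK : 0 ≤ K)
    (hθ : ∀ n, ‖n‖ ≤ K * ∑ j, ‖θ j n‖) (h : IsUnitaryGauge θ U D) (hA : ∀ j, EntryLp ⊤ (A j))
    (hA_decay : ∀ j a b, ExpDecay (mFourierCoeff fun t => A j t a b))
    (hB_decay : ∀ j a b,
      ExpDecay (mFourierCoeff fun t => gaugeConnection (U t) (D j t) (A j t) a b)) (a b : ν) :
    ExpDecay (mFourierCoeff fun t => U t a b) := by
  set B : κ → UnitAddTorus ι → Matrix ν ν ℂ := fun j t => gaugeConnection (U t) (D j t) (A j t)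
  have hB (j : κ) : EntryLp 2 (B j) := h.entryLp_gaugeConnection (hA j) j
  have hA₂ (j : κ) : EntryLp 2 (A j) := (hA j).mono le_top
  have hsystem (j : κ) : ∀ᵐ t, (D j t).vec = ((B j t)ᵀ ⊗ₖ 1 - 1 ⊗ₖ A j t) *ᵥ (U t).vec := by
    filter_upwards [h.mem_unitaryGroup] with t ht
    rw [Matrix.sub_mulVec, Matrix.kronecker_mulVec_vec, Matrix.kronecker_mulVec_vec,
      Matrix.one_mul, Matrix.transpose_transpose, mul_gaugeConnection ht, Matrix.transpose_one,
      Matrix.mul_one, ← Matrix.vec_sub, add_sub_cancel_right]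
  refine expDecay_of_linear_system hK hθ (u := fun p t => (U t).vec p)
    (M := fun j p q t => ((B j t)ᵀ ⊗ₖ 1 - 1 ⊗ₖ A j t : Matrix (ν × ν) (ν × ν) ℂ) p q)
    (fun p => h.entryLp p.2 p.1) (fun j p q => ?_) (fun j p q => ?_) (fun j p n => ?_) (b, a)
  · exact ((hB j q.1 p.1).mul_const _).sub ((hA₂ j p.2 q.2).const_mul _)
  · exact expDecay_mFourierCoeff_mul_sub_mul ((hB j).mono one_le_two |>.integrable q.1 p.1)
      ((hA₂ j).mono one_le_two |>.integrable p.2 q.2) (hB_decay j q.1 p.1) (hA_decay j p.2 q.2) _ _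
  · exact (mFourierCoeff_congr_ae ((hsystem j).mono fun t ht => (congrFun ht p).symm) n).trans
      (h.fourierDeriv j p.2 p.1 n)

theorem eq_zero_of_symbol_eq_zero [Fintype κ] {K : ℝ} (hθ : ∀ n, ‖n‖ ≤ K * ∑ j, ‖θ j n‖)
    {n : ι → ℤ} (hn : ∀ j, θ j n = 0) : n = 0 :=
  norm_le_zero_iff.mp ((hθ n).trans_eq (by simp [hn]))

theorem injective_symbol_of_subsingleton [Fintype κ] [Subsingleton κ] {K : ℝ}
    (hθ : ∀ n, ‖n‖ ≤ K * ∑ j, ‖θ j n‖) (j : κ) : Function.Injective (θ j) :=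
  (injective_iff_map_eq_zero _).mpr fun _ hn =>
    eq_zero_of_symbol_eq_zero hθ fun i => Subsingleton.elim j i ▸ hn

theorem IsUnitaryGauge.expDecay [Fintype κ] (h : IsUnitaryGauge θ U D)
    (hκν : Subsingleton κ ∨ Subsingleton ν) (hskew : ∀ j n, conj (θ j n) = -θ j n) {K : ℝ}
    (hK : 0 ≤ K) (hθ : ∀ n, ‖n‖ ≤ K * ∑ j, ‖θ j n‖) (hA : IsBoundedConnection θ A A')
    (hA_decay : ∀ j a b, ExpDecay (mFourierCoeff fun t => A j t a b)) {g : κ → ν → ℂ}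
    (hEL : MatFourierDiv θ D fun t =>
      ∑ j, lowerTerm s (U t) (D j t) (A j t) (A' j t) (Matrix.diagonal (g j))) (a b : ν) :
    ExpDecay (mFourierCoeff fun t => U t a b) := by
  refine h.expDecay_of_gaugeConnection hK hθ hA.entryLp hA_decay ?_ a b
  rcases hκν with hκ | hν
  · exact h.expDecay_gaugeConnection_of_injective hskew (injective_symbol_of_subsingleton hθ) hA hEL
  · exact h.expDecay_gaugeConnection_of_subsingleton hskew
      (fun n => eq_zero_of_symbol_eq_zero hθ) hA hA_decay hEL

end GaugeDecay

/-! ### The Berry connection -/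

section Berry

variable {d m : ℕ} {γ : Module.Basis (Fin d) ℝ (Space d)} {χ : Fin m → Space d → Fiber γ}

theorem analyticOnNhd_berry (hχ : ∀ a, AnalyticOnNhd ℝ (χ a) univ) (j : Fin d) (a b : Fin m) :
    AnalyticOnNhd ℝ (fun k => berry χ j k a b) univ := by
  rw [← contDiff_omega_iff_analyticOnNhd]
  have hderiv : ContDiff ℝ ω (fderiv ℝ (χ b)) := contDiff_omega_iff_analyticOnNhd.mpr (hχ b).fderiv
  exact (contDiff_omega_iff_analyticOnNhd.mpr (hχ a)).inner ℂ (hderiv.clm_apply contDiff_const)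

theorem IsBlochFrame.sub_eq_tau {P : Space d → Fiber γ →L[ℂ] Fiber γ} (hχ : IsBlochFrame γ P χ)
    (hcont : ∀ a, Continuous (χ a)) (a : Fin m) (l : dualLattice γ) (k : Space d) :
    χ a (k - l) = tau γ l (χ a k) :=
  congrFun ((Continuous.ae_eq_iff_eq volume ((hcont a).comp (continuous_id.sub continuous_const))
    ((tau γ l).continuous.comp (hcont a))).mp ((hχ.quasiBloch a).memHTau.equivariant l)) k

theorem partialDeriv_sub_eq_tau {f : Space d → Fiber γ} (hf : Differentiable ℝ f)
    {l : dualLattice γ} (h : ∀ k, f (k - l) = tau γ l (f k)) (j : Fin d) (k : Space d) :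
    partialDeriv j f (k - l) = tau γ l (partialDeriv j f k) := by
  have hderiv : HasFDerivAt (fun k => tau γ l (f k))
      ((((tau γ l).toContinuousLinearEquiv : Fiber γ →L[ℂ] Fiber γ).restrictScalars ℝ).comp
        (fderiv ℝ f k)) k :=
    (((tau γ l).toContinuousLinearEquiv : Fiber γ →L[ℂ] Fiber γ).restrictScalars
      ℝ).hasFDerivAt.comp k (hf k).hasFDerivAt
  rw [partialDeriv, ← fderiv_comp_sub, funext h, hderiv.fderiv]
  rfl

theorem isPeriodic_berry {P : Space d → Fiber γ →L[ℂ] Fiber γ} (hχ : IsBlochFrame γ P χ)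
    (hdiff : ∀ a, Differentiable ℝ (χ a)) (j : Fin d) : IsPeriodic γ (berry χ j) := by
  have htau := hχ.sub_eq_tau fun a => (hdiff a).continuous
  intro k l hl
  ext a b
  have hvalue := htau a ⟨-l, neg_mem hl⟩ k
  have hderiv := partialDeriv_sub_eq_tau (hdiff b) (htau b ⟨-l, neg_mem hl⟩) j k
  simp only [sub_neg_eq_add] at hvalue hderiv
  simp only [berry, Matrix.of_apply]
  rw [hvalue, hderiv, LinearIsometryEquiv.inner_map_map]

end Berry

/-! ### Weak equations in terms of Fourier coefficients -/

section Weak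

variable {d m : ℕ} {γ : Module.Basis (Fin d) ℝ (Space d)}

theorem trace_single_conjTranspose_mul (a b : Fin m) (x : ℂ) (M : Matrix (Fin m) (Fin m) ℂ) :
    ((Matrix.single a b x)ᴴ * M).trace = conj x * M a b := by
  rw [Matrix.conjTranspose_single, Matrix.trace_single_mul]
  rfl

theorem matPartialDeriv_single_char (j : Fin d) (a b : Fin m) (n : Fin d → ℤ) (k : Space d) :
    matPartialDeriv j (fun k => Matrix.single a b (char γ n k)) k =
      Matrix.single a b (symbol γ (EuclideanSpace.single j 1) n * char γ n k) := by
  ext a' b'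
  simp only [matPartialDeriv, partialDeriv, Matrix.of_apply, Matrix.single_apply]
  split_ifs
  · exact fderiv_char γ n k _
  · simp

theorem isTestFunction_single_char (a b : Fin m) (n : Fin d → ℤ) :
    IsTestFunction γ fun k => Matrix.single a b (char γ n k) := by
  refine ⟨(isPeriodic_char γ n).comp (Matrix.single a b), fun a' b' => ?_⟩
  simp only [Matrix.single_apply]
  split_ifs
  · exact contDiff_char γ n
  · exact contDiff_const

theorem exists_mFourierCoeff_cellSection (γ : Module.Basis (Fin d) ℝ (Space d)) :
    ∃ c : ℝ, ∀ (f : Space d → ℂ) (n : Fin d → ℤ),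
      mFourierCoeff (fun t => f (cellSection γ t)) n =
        c * ∫ k in dualCell γ, conj (char γ n k) * f k := by
  obtain ⟨c, hc⟩ := exists_integral_cellSection γ
  refine ⟨c, fun f n => ?_⟩
  rw [← hc fun k => conj (char γ n k) * f k, mFourierCoeff_eq_integral_mul]
  simp only [char_cellSection, mFourier_neg]

theorem IsWeakGradient.matFourierDeriv {U : Space d → Matrix (Fin m) (Fin m) ℂ}
    {DU : Fin d → Space d → Matrix (Fin m) (Fin m) ℂ} (h : IsWeakGradient γ U DU) (j : Fin d) :
    MatFourierDeriv (symbol γ (EuclideanSpace.single j 1)) (fun t => U (cellSection γ t))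
      fun t => DU j (cellSection γ t) := by
  intro a b n
  obtain ⟨c, hc⟩ := exists_mFourierCoeff_cellSection γ
  have hparts := h.integral_eq j _ (isTestFunction_single_char a b n)
  simp only [matPartialDeriv_single_char, trace_single_conjTranspose_mul, map_mul, conj_symbol,
    mul_assoc, neg_mul, integral_neg, integral_const_mul, neg_inj] at hparts
  rw [hc fun k => DU j k a b, hc fun k => U k a b, ← hparts]
  ring

theorem matFourierDiv_of_isTestFunction {H L : Fin d → Space d → Matrix (Fin m) (Fin m) ℂ}
    (hH : ∀ j, EntryLp 1 fun t => H j (cellSection γ t))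
    (hL : ∀ j, EntryLp 1 fun t => L j (cellSection γ t))
    (h : ∀ φ : Space d → Matrix (Fin m) (Fin m) ℂ, IsTestFunction γ φ →
      ∑ j, ∫ k in dualCell γ, ((matPartialDeriv j φ k)ᴴ * H j k + (φ k)ᴴ * L j k).trace = 0) :
    MatFourierDiv (fun j => symbol γ (EuclideanSpace.single j 1))
      (fun j t => H j (cellSection γ t)) fun t => ∑ j, L j (cellSection γ t) := by
  intro a b n
  set θ : Fin d → (Fin d → ℤ) →+ ℂ := fun j => symbol γ (EuclideanSpace.single j 1)
  obtain ⟨c, hc⟩ := exists_mFourierCoeff_cellSection γ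
  have hcoeff (j : Fin d) : mFourierCoeff (fun t => L j (cellSection γ t) a b) n -
      θ j n * mFourierCoeff (fun t => H j (cellSection γ t) a b) n =
      c * ∫ k in dualCell γ, conj (char γ n k) * (L j k a b - θ j n * H j k a b) := by
    rw [← hc fun k => L j k a b - θ j n * H j k a b, ← mFourierCoeff_const_mul,
      ← mFourierCoeff_sub ((hL j).integrable a b) (((hH j).integrable a b).const_mul _)]
  have hweak := h _ (isTestFunction_single_char a b n)
  simp only [matPartialDeriv_single_char, Matrix.trace_add, trace_single_conjTranspose_mul, map_mul,
    conj_symbol] at hweak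
  have hsum : ∑ j, (mFourierCoeff (fun t => L j (cellSection γ t) a b) n -
      θ j n * mFourierCoeff (fun t => H j (cellSection γ t) a b) n) = 0 := by
    simp only [hcoeff, ← Finset.mul_sum]
    refine mul_eq_zero_of_right _ (Eq.trans ?_ hweak)
    refine Finset.sum_congr rfl fun j _ => congrArg _ (funext fun k => ?_)
    ring
  simp only [Matrix.sum_apply]
  rw [mFourierCoeff_sum _ fun j _ => (hL j).integrable a b]
  rw [Finset.sum_sub_distrib, sub_eq_zero] at hsum
  exact hsum.symm

end Weak

/-! ### Regularity -/

section Regularity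

variable {d m : ℕ} {γ : Module.Basis (Fin d) ℝ (Space d)}
  {U : Space d → Matrix (Fin m) (Fin m) ℂ}

theorem mem_unitaryGroup_of_ae_eq {V : Space d → Matrix (Fin m) (Fin m) ℂ} (hV : Continuous V)
    (hUV : U =ᵐ[volume] V) (hU : ∀ᵐ k, U k ∈ Matrix.unitaryGroup (Fin m) ℂ) (k : Space d) :
    V k ∈ Matrix.unitaryGroup (Fin m) ℂ := by
  have hae : (fun k => V k * (V k)ᴴ) =ᵐ[volume] fun _ => 1 := by
    filter_upwards [hUV, hU] with k hk hk_unitary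
    rw [← hk]
    exact Matrix.mem_unitaryGroup_iff.mp hk_unitary
  have heq := (Continuous.ae_eq_iff_eq volume (hV.matrix_mul hV.matrix_conjTranspose)
    continuous_const).mp hae
  exact Matrix.mem_unitaryGroup_iff.mpr (congrFun heq k)

theorem isRealAnalytic_of_expDecay (hU : MemL2 γ U)
    (hunitary : ∀ᵐ k, U k ∈ Matrix.unitaryGroup (Fin m) ℂ)
    (hdecay : ∀ a b, ExpDecay (mFourierCoeff fun t => U (cellSection γ t) a b)) :
    IsRealAnalytic γ U := by
  set V : Space d → Matrix (Fin m) (Fin m) ℂ := fun k => Matrix.of fun a b =>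
    ∑' n, mFourierCoeff (fun t => U (cellSection γ t) a b) n * char γ n k with hV
  have hperiodic : IsPeriodic γ V := fun k l hl => by
    simp only [hV, isPeriodic_char γ _ k l hl]
  have hanalytic (a b : Fin m) : AnalyticOnNhd ℝ (fun k => V k a b) univ :=
    analyticOnNhd_tsum_char γ (hdecay a b)
  have hcontinuous : Continuous V := continuous_matrix fun a b =>
    (contDiff_omega_iff_analyticOnNhd.mpr (hanalytic a b)).continuous
  have hentries : ∀ᵐ t, ∀ a b, U (cellSection γ t) a b = V (cellSection γ t) a b := by
    simp only [ae_all_iff]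
    exact fun a b => ae_eq_tsum_char γ (memLp_comp_cellSection γ (hU.memLp a b)) (hdecay a b)
  have hUV : U =ᵐ[volume] V := hU.periodic.ae_eq_of_ae_eq_cellSection hperiodic
    (hentries.mono fun t ht => Matrix.ext ht)
  exact ⟨V, hperiodic, mem_unitaryGroup_of_ae_eq hcontinuous hUV hunitary, hanalytic, hUV⟩

theorem IsWeakGradient.isUnitaryGauge {DU : Fin d → Space d → Matrix (Fin m) (Fin m) ℂ}
    (h : IsWeakGradient γ U DU) (hU : MemL2 γ U)
    (hunitary : ∀ᵐ k, U k ∈ Matrix.unitaryGroup (Fin m) ℂ) :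
    IsUnitaryGauge (fun j => symbol γ (EuclideanSpace.single j 1))
      (fun t => U (cellSection γ t)) fun j t => DU j (cellSection γ t) where
  mem_unitaryGroup := (ae_cellSection_iff γ (p := fun k => U k ∈ Matrix.unitaryGroup (Fin m) ℂ)).mpr
    (ae_restrict_of_ae hunitary)
  entryLp a b := memLp_comp_cellSection γ (hU.memLp a b)
  entryLp_deriv j a b := memLp_comp_cellSection γ ((h.memL2 j).memLp a b)
  fourierDeriv j := h.matFourierDeriv j

variable {A : Fin d → Space d → Matrix (Fin m) (Fin m) ℂ}

theorem isBoundedConnection_of_contDiff (hA : ∀ j, IsPeriodic γ (A j))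
    (hA₁ : ∀ j a b, ContDiff ℝ 1 fun k => A j k a b) :
    IsBoundedConnection (fun j => symbol γ (EuclideanSpace.single j 1))
      (fun j t => A j (cellSection γ t)) fun j t => matPartialDeriv j (A j) (cellSection γ t) where
  entryLp j a b := ((hA j).comp (· a b)).memLp_top (hA₁ j a b).continuous
  entryLp_deriv j a b :=
    (((hA j).comp (· a b)).isPeriodic_fderiv.comp (· (EuclideanSpace.single j 1))).memLp_top
      (((hA₁ j a b).continuous_fderiv (by simp)).clm_apply continuous_const)
  fourierDeriv j a b := ((hA j).comp (· a b)).hasFourierDeriv (hA₁ j a b) _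

theorem IsWeakSolution.expDecay {s : ℝ} (hEL : IsWeakSolution γ s A U) (hdm : d = 1 ∨ m = 1)
    (hA : ∀ j, IsPeriodic γ (A j))
    (hA_analytic : ∀ j a b, AnalyticOnNhd ℝ (fun k => A j k a b) univ) (hU : MemL2 γ U)
    (hunitary : ∀ᵐ k, U k ∈ Matrix.unitaryGroup (Fin m) ℂ) (a b : Fin m) :
    ExpDecay (mFourierCoeff fun t => U (cellSection γ t) a b) := by
  obtain ⟨DU, hgrad, hweak⟩ := hEL
  obtain ⟨K, hK, hsymbol⟩ := exists_norm_le_sum_norm_symbol γ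
  have hgauge := hgrad.isUnitaryGauge hU hunitary
  have hconn := isBoundedConnection_of_contDiff hA fun j a b =>
    (contDiff_omega_iff_analyticOnNhd.mpr (hA_analytic j a b)).of_le le_top
  have hdiv := matFourierDiv_of_isTestFunction (L := lowerOrder γ s A U DU)
    (fun j => (hgauge.entryLp_deriv j).mono one_le_two)
    (fun j => hgauge.entryLp_lowerTerm hconn (diagMean γ A U DU j) j) hweak
  have hsubsingleton : Subsingleton (Fin d) ∨ Subsingleton (Fin m) := by
    rcases hdm with rfl | rfl
    exacts [.inl inferInstance, .inr inferInstance]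
  exact hgauge.expDecay hsubsingleton (fun j n => conj_symbol γ _ n) hK.le hsymbol hconn
    (fun j a b => ((hA j).comp (· a b)).expDecay_mFourierCoeff (hA_analytic j a b)) hdiv a b

end Regularity

end

end BlochGauge

theorem mainTheorem6_general (d m : ℕ) (hdm : d = 1 ∨ m = 1)
    (γ : Module.Basis (Fin d) ℝ (BlochGauge.Space d))
    (A : Fin d → BlochGauge.Space d → Matrix (Fin m) (Fin m) ℂ)
    (hA : ∀ j, BlochGauge.IsPeriodic γ (A j))
    (hA_analytic : ∀ j a b, AnalyticOnNhd ℝ (fun k => A j k a b) Set.univ) (s : ℝ)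
    (U : BlochGauge.Space d → Matrix (Fin m) (Fin m) ℂ) (hU : BlochGauge.MemL2 γ U)
    (hunitary : ∀ᵐ k, U k ∈ Matrix.unitaryGroup (Fin m) ℂ)
    (hEL : BlochGauge.IsWeakSolution γ s A U) : BlochGauge.IsRealAnalytic γ U :=
  BlochGauge.isRealAnalytic_of_expDecay hU hunitary
    (hEL.expDecay hdm hA hA_analytic hU hunitary)

theorem mainTheorem6 (d m : ℕ) (hdm : (d = 1 ∧ 1 ≤ m) ∨ (1 ≤ d ∧ m = 1))
    (γ : Module.Basis (Fin d) ℝ (BlochGauge.Space d))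
    (P : BlochGauge.Space d → BlochGauge.Fiber γ →L[ℂ] BlochGauge.Fiber γ)
    (hP : BlochGauge.IsProjectorFamily γ m P)
    (χ : Fin m → BlochGauge.Space d → BlochGauge.Fiber γ)
    (hχ : BlochGauge.IsBlochFrame γ P χ)
    (hχ_analytic : ∀ a, AnalyticOnNhd ℝ (χ a) Set.univ)
    (s : ℝ) (hs : s = 1 ∨ s = -1)
    (U : BlochGauge.Space d → Matrix (Fin m) (Fin m) ℂ)
    (hU : BlochGauge.MemW12Unitary γ U)
    (hEL : BlochGauge.IsWeakSolution γ s (BlochGauge.berry χ) U) :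
    BlochGauge.IsRealAnalytic γ U :=
  mainTheorem6_general d m (hdm.imp And.left And.right) γ _
    (BlochGauge.isPeriodic_berry hχ fun a k => (hχ_analytic a k trivial).differentiableAt)
    (BlochGauge.analyticOnNhd_berry hχ_analytic) s U hU.memL2 hU.unitary hEL
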